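/- Let $n\ge 2$ and $k\ge 1$ be integers, and let $\mathcal L\subset\mathbb R^n$ be a full-rank lattice that is integral, i.e. $\langle x,y\rangle\in\mathbb Z$ for all $x,y\in\mathcal L$. Suppose that $$\bigl|\{y\in\mathcal L:\|y\|^2=k\}\bigr| = 2\binom{n+2k-2}{2k-1},$$ and put $X=\tfrac1{\sqrt k}\{y\in\mathcal L:\|y\|^2=k\}\subset S^{n-1}$ and $A(X)=\{\langle x,y\rangle : x,y\in X,\ x\neq y\}$. A finite nonempty set $Y\subset S^{n-1}$ is a spherical $t$-design if $\frac1{|Y|}\sum_{x\in Y}f(x)=\int_{S^{n-1}}f\,d\sigma$ for every real polynomial $f$ on $\mathbb R^n$ of total degree at most $t$, where $\sigma$ is the normalized rotation-invariant measure on $S^{n-1}$. It is tight if moreover $|Y|=\binom{n+e-1}{e}+\binom{n+e-2}{e-1}$ when $t=2e$ (the second term being $0$ for $e=0$), respectively $|Y|=2\binom{n+e-1}{e}$ when $t=2e+1$. Let $Q_i^{(n)}$ be the Gegenbauer polynomials normalized by $Q_i^{(n)}(1)=\dim\operatorname{Harm}_i(\mathbb R^n)$, that is, $Q_0^{(n)}=1$,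 $Q_1^{(n)}(u)=nu$ and $$\lambda_{i+2}Q_{i+2}^{(n)}(u)=u\,Q_{i+1}^{(n)}(u)-(1-\lambda_i)Q_i^{(n)}(u)\quad(i\ge0),\qquad \lambda_0=0,\quad \lambda_i=\frac{i}{n+2i-2}\ (i\ge1),$$ and let $\mathcal C_m^{(n)}=Q_m^{(n)}+Q_{m-2}^{(n)}+Q_{m-4}^{(n)}+\cdots$, the sum ending in $Q_0^{(n)}$ or $Q_1^{(n)}$ according to the parity of $m$. Then: 1. $A(X)=\{-1\}\cup\{j/k : j\in\mathbb Z,\ -k<j<k\}$. 2. $X$ is antipodal ($X=-X$) and is a tight spherical $(4k-1)$-design. 3. With $F_X(u)=\prod_{\alpha\in A(X)}\frac{u-\alpha}{1-\alpha}$, one has the polynomial identity $$2\binom{n+2k-2}{2k-1}F_X(u)=(1+u)\,\mathcal C_{2k-1}^{(n)}(u).$$ 4. The set of (complex) roots of $\mathcal C_{2k-1}^{(n)}$ is exactly $\left\{0,\pm\frac1k,\pm\frac2k,\ldots,\pm\frac{k-1}{k}\right\}$. -/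

import Mathlib

open MeasureTheory Polynomial
open scoped Pointwise RealInnerProductSpace

noncomputable section

namespace LatticeShell

/-- A lattice is integral if all inner products of its vectors are integers. -/
def IsIntegralLattice {n : ℕ} (L : Submodule ℤ (EuclideanSpace ℝ (Fin n))) : Prop :=
  ∀ x ∈ L, ∀ y ∈ L, ∃ m : ℤ, ⟪x, y⟫ = (m : ℝ)

/-- The norm-`k` shell: lattice vectors of squared length `k`. -/
def shell {n : ℕ} (L : Submodule ℤ (EuclideanSpace ℝ (Fin n))) (k : ℕ) :
    Set (EuclideanSpace ℝ (Fin n)) :=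
  {y | y ∈ L ∧ ‖y‖ ^ 2 = (k : ℝ)}

/-- The normalized norm-`k` shell, the shell scaled by `1 / √k`. -/
def normalizedShell {n : ℕ} (L : Submodule ℤ (EuclideanSpace ℝ (Fin n))) (k : ℕ) :
    Set (EuclideanSpace ℝ (Fin n)) :=
  (1 / Real.sqrt (k : ℝ)) • shell L k

/-- A set is antipodal if it equals its negative. -/
def IsAntipodal {n : ℕ} (X : Set (EuclideanSpace ℝ (Fin n))) : Prop :=
  X = -X

/-- The set of inner products of distinct elements. -/
def innerProductSet {n : ℕ} (X : Set (EuclideanSpace ℝ (Fin n))) : Set ℝ :=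
  {a | ∃ x ∈ X, ∃ y ∈ X, x ≠ y ∧ a = ⟪x, y⟫}

/-- The surface measure of the unit sphere, normalized to total mass one. -/
def sphereMeasure (n : ℕ) : Measure (Metric.sphere (0 : EuclideanSpace ℝ (Fin n)) 1) :=
  ((volume : Measure (EuclideanSpace ℝ (Fin n))).toSphere Set.univ)⁻¹ •
    (volume : Measure (EuclideanSpace ℝ (Fin n))).toSphere

/-- Spherical `t`-designs: finite nonempty subsets of the unit sphere over which every polynomial
of total degree at most `t` has the same average as over the whole sphere. -/
structure IsSphericalDesign {n : ℕ} (t : ℕ) (X : Set (EuclideanSpace ℝ (Fin n))) : Prop where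
  finite : X.Finite
  nonempty : X.Nonempty
  subset_sphere : X ⊆ Metric.sphere 0 1
  average_eq : ∀ f : MvPolynomial (Fin n) ℝ, f.totalDegree ≤ t →
    (1 / (X.ncard : ℝ)) * ∑ᶠ x ∈ X, MvPolynomial.eval (fun i => x i) f =
      ∫ u : Metric.sphere (0 : EuclideanSpace ℝ (Fin n)) 1,
        MvPolynomial.eval (fun i => (u : EuclideanSpace ℝ (Fin n)) i) f ∂(sphereMeasure n)

/-- The Fisher-type lower bound for the size of a spherical `t`-design in dimension `n`:
`binom(n+e-1, e) + binom(n+e-2, e-1)` if `t = 2e` (the second term being `0` for `e = 0`), and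
`2 * binom(n+e-1, e)` if `t = 2e+1`. -/
def designBound (n t : ℕ) : ℕ :=
  if Even t then
    (n + t / 2 - 1).choose (t / 2) + (if t = 0 then 0 else (n + t / 2 - 2).choose (t / 2 - 1))
  else 2 * (n + t / 2 - 1).choose (t / 2)

/-- A tight spherical `t`-design: one of the least size allowed by the Fisher-type bound. -/
def IsTightSphericalDesign {n : ℕ} (t : ℕ) (X : Set (EuclideanSpace ℝ (Fin n))) : Prop :=
  IsSphericalDesign t X ∧ X.ncard = designBound n t

/-- The coefficients `λ_i = i / (n + 2i - 2)` of the Gegenbauer recurrence; `λ_0 = 0` for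
every `n`, also for `n = 2`, since Lean's `0 / 0` is `0`. -/
def gegenbauerCoeff (n i : ℕ) : ℝ := (i : ℝ) / ((n : ℝ) + 2 * (i : ℝ) - 2)

/-- The Gegenbauer polynomials `Q_i^{(n)}` in the normalization `Q_i^{(n)}(1) = dim Harm_i(ℝ^n)`,
given by `Q_0 = 1`, `Q_1 = n u` and
`λ_{i+2} Q_{i+2} = u Q_{i+1} - (1 - λ_i) Q_i`. -/
def gegenbauerQ (n : ℕ) : ℕ → ℝ[X]
  | 0 => 1
  | 1 => C (n : ℝ) * X
  | i + 2 => C (gegenbauerCoeff n (i + 2))⁻¹ *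
      (X * gegenbauerQ n (i + 1) - C (1 - gegenbauerCoeff n i) * gegenbauerQ n i)

/-- The cumulative sum `Q_m + Q_{m-2} + Q_{m-4} + ⋯`, ending in `Q_0` or `Q_1`. -/
def gegenbauerSum (n m : ℕ) : ℝ[X] :=
  ∑ j ∈ Finset.range (m / 2 + 1), gegenbauerQ n (m - 2 * j)

/-- The annihilator polynomial `∏ (u - α) / (1 - α)` over the inner products `α` of distinct
elements of `X`. -/
def annihilator {n : ℕ} (X : Set (EuclideanSpace ℝ (Fin n))) : ℝ[X] :=
  ∏ᶠ α ∈ innerProductSet X, C (1 / (1 - α)) * (Polynomial.X - C α)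

end LatticeShell

end

namespace LatticeShell

/-! ### Gegenbauer polynomials -/

/-! Put `e = 2k - 1`. Integrality and Cauchy–Schwarz force every inner product of two points of `X`
that are neither equal nor opposite into the `e` fractions `j/k` with `|j| < k`. Let `g` be the
polynomial vanishing at these fractions with `g 1 = 1`; it has degree at most `e` and the parity of
`e`. The assumed size of `X` is twice the dimension of the space of forms of degree `e` in `n`
variables.

Take one point from each antipodal pair, forming `Y`. The zonal functions `g ⟪y, ·⟫` extend from the
sphere to forms of degree `e` dual to the points of `Y`. Since `Y` has as many points as the space
has dimensions, they are a basis, and every form of degree `e` is interpolated from its values on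
`Y` (`eval_eq_sum_of_card_eq`, `IsTightCode.two_mul_eval`).

The design property follows without harmonic analysis. Applying the interpolation formula in two
ways to a double sum shows that `∑ x, ⟪v, x⟫ ^ (2e)` depends only on `‖v‖`
(`IsTightCode.isInvariantInDegree`). A normalized functional with this invariance is determined on
forms of degree `2e`; lower even degrees reduce to this one by multiplying with `‖x‖²`, and odd
degrees vanish by antipodality. So the average over `X` is the spherical integral up to degree `2e +
1 = 4k - 1`.

The remaining claims rest on `IsTightCode.eq_zero_of_nonneg`, the positivity of the zonal integral.
It excludes a missing inner product (`IsTightCode.exists_inner_eq`). It also identifies a multiple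
of `g` with the cumulative Gegenbauer sum (`IsTightCode.C_mul_eq_gegenbauerSum`), because both have
the same moments against powers of degree at most `e`. The annihilator identity and the roots can
then be read off from the factors of `g`. -/

theorem gegenbauerCoeff_zero (n : ℕ) : gegenbauerCoeff n 0 = 0 := by simp [gegenbauerCoeff]

theorem gegenbauerCoeff_succ (n i : ℕ) :
    gegenbauerCoeff n (i + 1) = ((i : ℝ) + 1) / ((n : ℝ) + 2 * i) := by
  simp only [gegenbauerCoeff, Nat.cast_add, Nat.cast_one]
  congr 1
  ring

theorem gegenbauerCoeff_succ_pos {n : ℕ} (hn : 1 ≤ n) (i : ℕ) :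
    0 < gegenbauerCoeff n (i + 1) := by
  rw [gegenbauerCoeff_succ]
  have : (1 : ℝ) ≤ n := by exact_mod_cast hn
  positivity

theorem X_mul_gegenbauerQ_zero {n : ℕ} (hn : 1 ≤ n) :
    X * gegenbauerQ n 0 = C (gegenbauerCoeff n 1) * gegenbauerQ n 1 := by
  have h : (n : ℝ) ≠ 0 := by positivity
  have h1 := gegenbauerCoeff_succ n 0
  simp only [zero_add, Nat.cast_zero, mul_zero, add_zero] at h1
  rw [gegenbauerQ, gegenbauerQ, h1, ← mul_assoc, ← C_mul, one_div_mul_cancel h]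
  simp

theorem X_mul_gegenbauerQ_succ {n : ℕ} (hn : 1 ≤ n) (i : ℕ) :
    X * gegenbauerQ n (i + 1) = C (gegenbauerCoeff n (i + 2)) * gegenbauerQ n (i + 2) +
      C (1 - gegenbauerCoeff n i) * gegenbauerQ n i := by
  have h := (gegenbauerCoeff_succ_pos hn (i + 1)).ne'
  rw [show gegenbauerQ n (i + 2) = C (gegenbauerCoeff n (i + 2))⁻¹ *
      (X * gegenbauerQ n (i + 1) - C (1 - gegenbauerCoeff n i) * gegenbauerQ n i) from rfl,
    ← mul_assoc, ← C_mul, mul_inv_cancel₀ h]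
  simp

theorem gegenbauerQ_comp_neg_X (n i : ℕ) :
    (gegenbauerQ n i).comp (-X) = (-1) ^ i * gegenbauerQ n i := by
  induction i using Nat.twoStepInduction with
  | zero => simp [gegenbauerQ]
  | one => simp [gegenbauerQ]
  | more i ih1 ih2 =>
    simp only [gegenbauerQ, mul_comp, sub_comp, C_comp, X_comp, ih1, ih2]
    ring

theorem natDegree_gegenbauerQ_le (n i : ℕ) : (gegenbauerQ n i).natDegree ≤ i := by
  induction i using Nat.twoStepInduction with
  | zero => simp [gegenbauerQ]
  | one =>
    rw [gegenbauerQ]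
    exact (natDegree_C_mul_le _ _).trans natDegree_X_le
  | more i ih1 ih2 =>
    rw [gegenbauerQ]
    refine (natDegree_C_mul_le _ _).trans ((natDegree_sub_le _ _).trans (max_le ?_ ?_))
    · exact natDegree_mul_le.trans (by rw [natDegree_X]; omega)
    · exact (natDegree_C_mul_le _ _).trans (by omega)

theorem gegenbauerSum_add_two (n m : ℕ) :
    gegenbauerSum n (m + 2) = gegenbauerQ n (m + 2) + gegenbauerSum n m := by
  rw [gegenbauerSum, gegenbauerSum, show (m + 2) / 2 + 1 = (m / 2 + 1) + 1 by omega,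
    Finset.sum_range_succ', add_comm]
  congr 1
  exact Finset.sum_congr rfl fun j _ => by congr 1; omega

theorem gegenbauerSum_succ_add (n m : ℕ) :
    gegenbauerSum n (m + 1) + gegenbauerSum n m =
      ∑ i ∈ Finset.range (m + 2), gegenbauerQ n i := by
  induction m with
  | zero => simp [gegenbauerSum, Finset.sum_range_succ, add_comm]
  | succ m ih =>
    rw [gegenbauerSum_add_two, Finset.sum_range_succ, ← ih]
    ring

theorem gegenbauerSum_comp_neg_X (n m : ℕ) :
    (gegenbauerSum n m).comp (-X) = (-1) ^ m * gegenbauerSum n m := by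
  induction m using Nat.twoStepInduction with
  | zero => simp [gegenbauerSum, gegenbauerQ]
  | one => simp [gegenbauerSum, gegenbauerQ]
  | more m ih1 _ =>
    rw [gegenbauerSum_add_two, add_comp, ih1, gegenbauerQ_comp_neg_X]
    ring

theorem natDegree_gegenbauerSum_le (n m : ℕ) : (gegenbauerSum n m).natDegree ≤ m :=
  natDegree_sum_le_of_forall_le _ _ fun _ _ =>
    (natDegree_gegenbauerQ_le n _).trans (Nat.sub_le _ _)

/-- A linear functional on real polynomials with the moments of the distribution of a coordinate
of a uniformly random point on the unit sphere of `ℝ^n`. -/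
structure IsGegenbauerFunctional (n : ℕ) (φ : ℝ[X] →ₗ[ℝ] ℝ) : Prop where
  one : φ 1 = 1
  odd : ∀ j, φ (X ^ (2 * j + 1)) = 0
  even : ∀ j : ℕ, (2 * (j : ℝ) + 1) * φ (X ^ (2 * j)) = ((n : ℝ) + 2 * j) * φ (X ^ (2 * j + 2))

namespace IsGegenbauerFunctional

variable {n : ℕ} {φ : ℝ[X] →ₗ[ℝ] ℝ}

theorem moment_succ_succ (h : IsGegenbauerFunctional n φ) (j : ℕ) :
    ((j : ℝ) + 1) * φ (X ^ j) = ((n : ℝ) + j) * φ (X ^ (j + 2)) := by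
  rcases Nat.even_or_odd' j with ⟨i, rfl | rfl⟩
  · simpa using h.even i
  · rw [h.odd i, show 2 * i + 1 + 2 = 2 * (i + 1) + 1 by ring, h.odd (i + 1)]
    simp

theorem apply_C_mul (φ : ℝ[X] →ₗ[ℝ] ℝ) (c : ℝ) (p : ℝ[X]) : φ (C c * p) = c * φ p := by
  rw [C_mul', map_smul, smul_eq_mul]

theorem recurrence (φ : ℝ[X] →ₗ[ℝ] ℝ) (hn : 1 ≤ n) (i j : ℕ) :
    φ (X ^ (j + 1) * gegenbauerQ n (i + 1)) =
      gegenbauerCoeff n (i + 2) * φ (X ^ j * gegenbauerQ n (i + 2)) +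
      (1 - gegenbauerCoeff n i) * φ (X ^ j * gegenbauerQ n i) := by
  rw [pow_succ, mul_assoc, X_mul_gegenbauerQ_succ hn, mul_add, map_add, mul_left_comm,
    apply_C_mul, mul_left_comm, apply_C_mul]

/-- Closed-form relations between neighbouring values of `φ (X ^ j * Q_i)`. -/
theorem neighbours (h : IsGegenbauerFunctional n φ) (hn : 1 ≤ n) (i : ℕ) :
    (∀ j : ℕ, gegenbauerCoeff n (i + 1) * ((n : ℝ) + i + j) *
        φ (X ^ (j + 1) * gegenbauerQ n (i + 1)) =
      (1 - gegenbauerCoeff n i) * (j + 1) * φ (X ^ j * gegenbauerQ n i)) ∧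
    (∀ j : ℕ, ((j : ℝ) + 1) * gegenbauerCoeff n (i + 1) * φ (X ^ j * gegenbauerQ n (i + 1)) =
      (1 - gegenbauerCoeff n i) * ((j : ℝ) + 1 - i) * φ (X ^ (j + 1) * gegenbauerQ n i)) := by
  have hn0 : (0 : ℝ) < n := by exact_mod_cast hn
  induction i with
  | zero =>
    have key (j : ℕ) : gegenbauerCoeff n (0 + 1) * φ (X ^ j * gegenbauerQ n (0 + 1)) =
        φ (X ^ (j + 1)) := by
      rw [← apply_C_mul, mul_left_comm, ← X_mul_gegenbauerQ_zero hn, gegenbauerQ, mul_one,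
        pow_succ]
    refine ⟨fun j => ?_, fun j => ?_⟩
    · have := h.moment_succ_succ j
      rw [mul_right_comm, key]
      simp only [gegenbauerCoeff_zero, gegenbauerQ, mul_one, Nat.cast_zero]
      linarith
    · rw [mul_assoc, key]
      simp [gegenbauerCoeff_zero, gegenbauerQ]
  | succ i ih =>
    obtain ⟨ih1, ih2⟩ := ih
    have hc := gegenbauerCoeff_succ_pos hn i
    have hsecond (j : ℕ) : ((j : ℝ) + 1) * gegenbauerCoeff n (i + 1 + 1) *
        φ (X ^ j * gegenbauerQ n (i + 1 + 1)) =
        (1 - gegenbauerCoeff n (i + 1)) * ((j : ℝ) + 1 - (i + 1 : ℕ)) *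
          φ (X ^ (j + 1) * gegenbauerQ n (i + 1)) := by
      have h1 := recurrence φ hn i j
      have h2 := ih1 j
      -- The only point of the induction where the actual value of `λ_{i+1}` enters.
      have h3 : (j : ℝ) + 1 - gegenbauerCoeff n (i + 1) * ((n : ℝ) + i + j) =
          (1 - gegenbauerCoeff n (i + 1)) * (j - i) := by
        rw [gegenbauerCoeff_succ]
        have : (n : ℝ) + 2 * i ≠ 0 := by positivity
        field_simp
        ring
      push_cast
      linear_combination (-(j + 1 : ℝ)) * h1 + h2 +
        φ (X ^ (j + 1) * gegenbauerQ n (i + 1)) * h3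
    refine ⟨fun j => ?_, hsecond⟩
    -- Going from `(i, j)` to `(i + 2, j + 1)` through the neighbours, all coefficients but the
    -- desired ones cancel.
    have h1 := hsecond (j + 1)
    have h2 := ih1 (j + 1)
    have h3 := ih2 j
    have hne : ((j : ℝ) + 2) * gegenbauerCoeff n (i + 1) ≠ 0 := by positivity
    apply mul_left_cancel₀ hne
    push_cast at h1 h2 ⊢
    linear_combination (gegenbauerCoeff n (i + 1) * ((n : ℝ) + (i + 1) + j)) * h1 +
      (1 - gegenbauerCoeff n (i + 1)) * (j + 1 - i) * h2 -
      (1 - gegenbauerCoeff n (i + 1)) * (j + 2) * h3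

/-- Orthogonality to constants. For `Q_2` the factor `j + 1 - i` in the second relation of
`neighbours` vanishes; beyond that, vanishing passes from `Q_{i+1}` to `X * Q_{i+2}` by the first
relation and on to `Q_{i+3}` by the second. -/
theorem apply_gegenbauerQ (h : IsGegenbauerFunctional n φ) (hn : 1 ≤ n) (i : ℕ) :
    φ (gegenbauerQ n (i + 1)) = 0 := by
  have hn0 : (0 : ℝ) < n := by exact_mod_cast hn
  induction i using Nat.twoStepInduction with
  | zero =>
    have h1 : φ X = 0 := by simpa using h.odd 0
    rw [gegenbauerQ, apply_C_mul, h1, mul_zero]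
  | one =>
    have hc := (gegenbauerCoeff_succ_pos hn 1).ne'
    simpa [hc] using (h.neighbours hn 1).2 0
  | more i ih _ =>
    have hc1 := (gegenbauerCoeff_succ_pos hn (i + 2)).ne'
    have hc2 := (gegenbauerCoeff_succ_pos hn (i + 1)).ne'
    have h1 := (h.neighbours hn (i + 2)).2 0
    have h2 := (h.neighbours hn (i + 1)).1 0
    have hne : (n : ℝ) + (i + 1 : ℕ) + (0 : ℕ) ≠ 0 := by positivity
    rw [pow_zero, one_mul, ih, mul_zero] at h2
    have h3 := (mul_eq_zero.1 h2).resolve_left (mul_ne_zero hc2 hne)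
    rw [h3, mul_zero, pow_zero, one_mul] at h1
    simpa [hc1] using h1

theorem apply_X_pow_mul_gegenbauerQ (h : IsGegenbauerFunctional n φ) (hn : 1 ≤ n) {i j : ℕ}
    (hij : j < i) : φ (X ^ j * gegenbauerQ n i) = 0 := by
  have hn0 : (0 : ℝ) < n := by exact_mod_cast hn
  induction j generalizing i with
  | zero =>
    obtain ⟨i, rfl⟩ : ∃ m, i = m + 1 := ⟨i - 1, by omega⟩
    simpa using h.apply_gegenbauerQ hn i
  | succ j ih =>
    obtain ⟨i, rfl⟩ : ∃ m, i = m + 1 := ⟨i - 1, by omega⟩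
    have h1 := (h.neighbours hn i).1 j
    rw [ih (by omega), mul_zero] at h1
    have hc := gegenbauerCoeff_succ_pos hn i
    exact (mul_eq_zero.1 h1).resolve_left (by positivity)

/-- Multiplying by `X` preserves the sum: in `X * ∑ Q_i` each `Q_i` receives `λ_i` from `Q_{i-1}`
and `1 - λ_i` from `Q_{i+1}`, together `1`. The defects at the upper end of the range are killed by
orthogonality. -/
theorem sum_apply_X_pow_mul_gegenbauerQ (h : IsGegenbauerFunctional n φ) (hn : 1 ≤ n)
    {j N : ℕ} (hj : j < N) : ∑ i ∈ Finset.range N, φ (X ^ j * gegenbauerQ n i) = 1 := by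
  induction j with
  | zero =>
    obtain ⟨N, rfl⟩ : ∃ m, N = m + 1 := ⟨N - 1, by omega⟩
    rw [Finset.sum_range_succ', Finset.sum_eq_zero]
    · simp [gegenbauerQ, h.one]
    · intro i _
      simpa using h.apply_gegenbauerQ hn i
  | succ j ih =>
    obtain ⟨N, rfl⟩ : ∃ m, N = m + 1 := ⟨N - 1, by omega⟩
    have h0 : φ (X ^ (j + 1) * gegenbauerQ n 0) =
        gegenbauerCoeff n 1 * φ (X ^ j * gegenbauerQ n 1) := by
      rw [pow_succ, mul_assoc, X_mul_gegenbauerQ_zero hn, mul_left_comm, apply_C_mul]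
    have h1 := Finset.sum_range_succ'
      (fun i => gegenbauerCoeff n i * φ (X ^ j * gegenbauerQ n i)) (N + 1)
    rw [Finset.sum_range_succ' (fun i => gegenbauerCoeff n (i + 1) *
      φ (X ^ j * gegenbauerQ n (i + 1))), Finset.sum_range_succ, Finset.sum_range_succ,
      h.apply_X_pow_mul_gegenbauerQ hn (show j < N + 1 by omega),
      h.apply_X_pow_mul_gegenbauerQ hn (show j < N by omega), gegenbauerCoeff_zero] at h1
    rw [Finset.sum_range_succ', h0, Finset.sum_congr rfl fun i _ => recurrence φ hn i j,
      Finset.sum_add_distrib]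
    have h2 := ih (by omega)
    rw [Finset.sum_range_succ, h.apply_X_pow_mul_gegenbauerQ hn (show j < N by omega)] at h2
    simp only [sub_mul, one_mul, Finset.sum_sub_distrib]
    simp only [zero_add, mul_zero, add_zero, zero_mul] at h1 ⊢
    linarith

theorem apply_comp_neg_X (h : IsGegenbauerFunctional n φ) (p : ℝ[X]) :
    φ (p.comp (-X)) = φ p := by
  induction p using Polynomial.induction_on' with
  | add p q hp hq => rw [add_comp, map_add, map_add, hp, hq]
  | monomial j a =>
    rw [← C_mul_X_pow_eq_monomial, mul_comp, C_comp, apply_C_mul, apply_C_mul, X_pow_comp]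
    rcases Nat.even_or_odd' j with ⟨i, rfl | rfl⟩
    · rw [Even.neg_pow (even_two_mul i)]
    · rw [Odd.neg_pow (odd_two_mul_add_one i), map_neg, h.odd, neg_zero]

theorem apply_eq_zero_of_comp_neg_X (h : IsGegenbauerFunctional n φ) {p : ℝ[X]}
    (hp : p.comp (-X) = -p) : φ p = 0 := by
  have := h.apply_comp_neg_X p
  rw [hp, map_neg] at this
  linarith

/-- The polynomial `Q_m + Q_{m-2} + ⋯` reproduces the value at `1` of polynomials of degree at
most `m` and of the parity of `m`. -/
theorem apply_X_pow_mul_gegenbauerSum (h : IsGegenbauerFunctional n φ) (hn : 1 ≤ n) {m j : ℕ}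
    (hj : j ≤ m) (hpar : Even (j + m)) : φ (X ^ j * gegenbauerSum n m) = 1 := by
  rcases m with _ | m
  · obtain rfl : j = 0 := by omega
    simp [gegenbauerSum, gegenbauerQ, h.one]
  -- The sum of the opposite parity contributes zero, so it may be added to complete the sum over
  -- all indices.
  · have h0 : φ (X ^ j * gegenbauerSum n m) = 0 := by
      apply h.apply_eq_zero_of_comp_neg_X
      rw [mul_comp, X_pow_comp, gegenbauerSum_comp_neg_X, neg_pow, mul_mul_mul_comm, ← pow_add,
        Odd.neg_one_pow (by rw [Nat.odd_iff]; rw [Nat.even_iff] at hpar; omega)]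
      ring
    rw [← add_zero (φ _), ← h0, ← map_add, ← mul_add, gegenbauerSum_succ_add, Finset.mul_sum,
      map_sum, h.sum_apply_X_pow_mul_gegenbauerQ hn (by omega)]

end IsGegenbauerFunctional

/-! ### Linear functionals on polynomials in several variables -/

/-- The linear form `x ↦ ⟪v, x⟫`. -/
noncomputable def linForm {n : ℕ} (v : EuclideanSpace ℝ (Fin n)) : MvPolynomial (Fin n) ℝ :=
  ∑ i, MvPolynomial.C (v i) * MvPolynomial.X i

/-- The quadratic form `x ↦ ‖x‖ ^ 2`. -/
noncomputable def normSqForm (n : ℕ) : MvPolynomial (Fin n) ℝ :=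
  ∑ i, MvPolynomial.X i ^ 2

section forms

variable {n : ℕ}

theorem eval_linForm (v x : EuclideanSpace ℝ (Fin n)) :
    MvPolynomial.eval (fun i => x i) (linForm v) = ⟪v, x⟫ := by
  simp [linForm, PiLp.inner_apply, mul_comm]

theorem eval_normSqForm (x : EuclideanSpace ℝ (Fin n)) :
    MvPolynomial.eval (fun i => x i) (normSqForm n) = ‖x‖ ^ 2 := by
  simp [normSqForm, EuclideanSpace.norm_sq_eq]

theorem isHomogeneous_linForm (v : EuclideanSpace ℝ (Fin n)) : (linForm v).IsHomogeneous 1 :=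
  MvPolynomial.IsHomogeneous.sum _ _ _ fun i _ => MvPolynomial.isHomogeneous_C_mul_X _ i

theorem isHomogeneous_linForm_pow (v : EuclideanSpace ℝ (Fin n)) (d : ℕ) :
    (linForm v ^ d).IsHomogeneous d := by
  simpa using (isHomogeneous_linForm v).pow d

theorem isHomogeneous_normSqForm (n : ℕ) : (normSqForm n).IsHomogeneous 2 :=
  MvPolynomial.IsHomogeneous.sum _ _ _ fun i _ => MvPolynomial.isHomogeneous_X_pow i 2

theorem isHomogeneous_normSqForm_pow (n d : ℕ) : (normSqForm n ^ d).IsHomogeneous (2 * d) :=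
  (isHomogeneous_normSqForm n).pow d

theorem linForm_neg (v : EuclideanSpace ℝ (Fin n)) : linForm (-v) = -linForm v := by
  simp [linForm]

theorem linForm_add (v w : EuclideanSpace ℝ (Fin n)) :
    linForm (v + w) = linForm v + linForm w := by
  simp [linForm, add_mul, Finset.sum_add_distrib]

theorem linForm_smul (c : ℝ) (v : EuclideanSpace ℝ (Fin n)) :
    linForm (c • v) = MvPolynomial.C c * linForm v := by
  simp [linForm, Finset.mul_sum, mul_assoc]

theorem linForm_single (i : Fin n) :
    linForm (EuclideanSpace.single i (1 : ℝ)) = MvPolynomial.X i := by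
  rw [linForm, Finset.sum_eq_single i]
  · simp
  · intro j _ hj
    simp [hj]
  · simp

theorem apply_mvC_mul (Λ : MvPolynomial (Fin n) ℝ →ₗ[ℝ] ℝ) (c : ℝ) (f : MvPolynomial (Fin n) ℝ) :
    Λ (MvPolynomial.C c * f) = c * Λ f := by
  rw [MvPolynomial.C_mul', map_smul, smul_eq_mul]

theorem linForm_smul_pow (c : ℝ) (v : EuclideanSpace ℝ (Fin n)) (d : ℕ) :
    linForm (c • v) ^ d = MvPolynomial.C (c ^ d) * linForm v ^ d := by
  rw [linForm_smul, mul_pow, MvPolynomial.C_pow]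

/-- Powers of linear forms span the homogeneous polynomials. -/
theorem apply_eq_zero_of_linForm_pow (Λ : MvPolynomial (Fin n) ℝ →ₗ[ℝ] ℝ) {d : ℕ}
    (h : ∀ v : EuclideanSpace ℝ (Fin n), Λ (linForm v ^ d) = 0) {f : MvPolynomial (Fin n) ℝ}
    (hf : f.IsHomogeneous d) : Λ f = 0 := by
  -- By the multinomial theorem `P` is `v ↦ Λ (linForm v ^ d)` as a polynomial in `v`. It vanishes
  -- everywhere, so its coefficients do, and the multinomial factors are nonzero.
  set P : MvPolynomial (Fin n) ℝ := ∑ k ∈ Finset.piAntidiag Finset.univ d,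
    MvPolynomial.monomial (Finsupp.equivFunOnFinite.symm k)
      ((Nat.multinomial Finset.univ k : ℝ) *
        Λ (MvPolynomial.monomial (Finsupp.equivFunOnFinite.symm k) 1)) with hP
  have hmon (k : Fin n → ℕ) (c : ℝ) :
      MvPolynomial.monomial (Finsupp.equivFunOnFinite.symm k) c =
        MvPolynomial.C c * ∏ i, (MvPolynomial.X i : MvPolynomial (Fin n) ℝ) ^ k i := by
    rw [MvPolynomial.monomial_eq, Finsupp.prod_fintype _ _ (by simp)]
    simp
  have hP0 : P = 0 := by
    apply MvPolynomial.funext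
    intro v
    have hv := h (WithLp.toLp 2 v)
    rw [linForm, Finset.sum_pow_eq_sum_piAntidiag, map_sum] at hv
    rw [map_zero, ← hv, hP, map_sum]
    refine Finset.sum_congr rfl fun k _ => ?_
    rw [hmon, hmon, MvPolynomial.C_1, one_mul]
    simp only [mul_pow, Finset.prod_mul_distrib, ← map_pow, ← map_prod]
    rw [← map_natCast (MvPolynomial.C (σ := Fin n) (R := ℝ)), apply_mvC_mul, apply_mvC_mul]
    simp
    ring
  have hcoeff (k : Fin n →₀ ℕ) (hk : k.degree = d) : Λ (MvPolynomial.monomial k 1) = 0 := by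
    have h1 : MvPolynomial.coeff k P = 0 := by rw [hP0, MvPolynomial.coeff_zero]
    rw [hP, MvPolynomial.coeff_sum, Finset.sum_eq_single (k : Fin n → ℕ)] at h1
    · rw [MvPolynomial.coeff_monomial] at h1
      simpa [(Nat.multinomial_pos _ _).ne'] using h1
    · intro l _ hl
      rw [MvPolynomial.coeff_monomial, if_neg]
      rintro rfl
      exact hl (by ext; simp)
    · intro hk'
      refine absurd ?_ hk'
      rw [Finset.mem_piAntidiag]
      refine ⟨?_, by simp⟩
      rw [← hk, Finsupp.degree_eq_sum]
  rw [f.as_sum, map_sum]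
  refine Finset.sum_eq_zero fun k hk => ?_
  have h1 : k.degree = d := by
    rw [Finsupp.degree_eq_weight_one]
    exact hf (MvPolynomial.mem_support_iff.1 hk)
  rw [← mul_one (MvPolynomial.coeff k f), ← MvPolynomial.C_mul_monomial, apply_mvC_mul,
    hcoeff k h1, mul_zero]

/-- Normalized linear functionals on polynomials which only depend on the restriction to the
unit sphere and which vanish on odd polynomials. -/
structure IsSphereAverage (Λ : MvPolynomial (Fin n) ℝ →ₗ[ℝ] ℝ) : Prop where
  one : Λ 1 = 1
  mul_normSqForm : ∀ f, Λ (f * normSqForm n) = Λ f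
  odd : ∀ v d, Odd d → Λ (linForm v ^ d) = 0

theorem IsSphereAverage.mul_normSqForm_pow {Λ : MvPolynomial (Fin n) ℝ →ₗ[ℝ] ℝ}
    (h : IsSphereAverage Λ) (f : MvPolynomial (Fin n) ℝ) (j : ℕ) :
    Λ (f * normSqForm n ^ j) = Λ f := by
  induction j with
  | zero => simp
  | succ j ih => rw [pow_succ, ← mul_assoc, h.mul_normSqForm, ih]

/-- The functional takes the same value on the `d`-th powers of linear forms of equal length. -/
def IsInvariantInDegree (Λ : MvPolynomial (Fin n) ℝ →ₗ[ℝ] ℝ) (d : ℕ) : Prop :=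
  ∀ v w : EuclideanSpace ℝ (Fin n), ‖v‖ = ‖w‖ → Λ (linForm v ^ d) = Λ (linForm w ^ d)

theorem IsInvariantInDegree.apply_linForm_pow {Λ : MvPolynomial (Fin n) ℝ →ₗ[ℝ] ℝ} {d : ℕ}
    (h : IsInvariantInDegree Λ d) {u : EuclideanSpace ℝ (Fin n)} (hu : ‖u‖ = 1)
    (v : EuclideanSpace ℝ (Fin n)) : Λ (linForm v ^ d) = ‖v‖ ^ d * Λ (linForm u ^ d) := by
  rw [h v (‖v‖ • u) (by simp [norm_smul, hu]), linForm_smul_pow, apply_mvC_mul]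

/-- On powers of linear forms each functional is a constant times `‖v‖ ^ (2e)`, and such powers
span, so the two functionals are proportional. Both take the value `1` on `normSqForm n ^ e`, which
fixes the ratio. -/
theorem IsSphereAverage.eq_of_isHomogeneous {Λ₁ Λ₂ : MvPolynomial (Fin n) ℝ →ₗ[ℝ] ℝ}
    (h₁ : IsSphereAverage Λ₁) (h₂ : IsSphereAverage Λ₂) (hn : 1 ≤ n) {e : ℕ}
    (hi₁ : IsInvariantInDegree Λ₁ (2 * e)) (hi₂ : IsInvariantInDegree Λ₂ (2 * e))
    {f : MvPolynomial (Fin n) ℝ} (hf : f.IsHomogeneous (2 * e)) : Λ₁ f = Λ₂ f := by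
  set u : EuclideanSpace ℝ (Fin n) := EuclideanSpace.single ⟨0, hn⟩ 1
  have hu : ‖u‖ = 1 := by simp [u]
  set c₁ := Λ₁ (linForm u ^ (2 * e)) with hc₁
  set c₂ := Λ₂ (linForm u ^ (2 * e)) with hc₂
  have key {g : MvPolynomial (Fin n) ℝ} (hg : g.IsHomogeneous (2 * e)) :
      c₂ * Λ₁ g = c₁ * Λ₂ g := by
    have := apply_eq_zero_of_linForm_pow (c₂ • Λ₁ - c₁ • Λ₂) (d := 2 * e) (fun v => by
      simp only [LinearMap.sub_apply, LinearMap.smul_apply, smul_eq_mul,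
        hi₁.apply_linForm_pow hu v, hi₂.apply_linForm_pow hu v, ← hc₁, ← hc₂]
      ring) hg
    simpa [sub_eq_zero] using this
  have hone {Λ : MvPolynomial (Fin n) ℝ →ₗ[ℝ] ℝ} (h : IsSphereAverage Λ) :
      Λ (normSqForm n ^ e) = 1 := by
    rw [← one_mul (normSqForm n ^ e), h.mul_normSqForm_pow, h.one]
  have hc : c₂ = c₁ := by
    have := key (isHomogeneous_normSqForm_pow n e)
    rwa [hone h₁, hone h₂, mul_one, mul_one] at this
  have hne : c₁ ≠ 0 := by
    intro h0
    have := apply_eq_zero_of_linForm_pow Λ₁ (d := 2 * e) (fun v => by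
      rw [hi₁.apply_linForm_pow hu v, ← hc₁, h0, mul_zero]) (isHomogeneous_normSqForm_pow n e)
    rw [hone h₁] at this
    exact one_ne_zero this
  have := key hf
  rw [hc] at this
  exact mul_left_cancel₀ hne this

theorem IsSphereAverage.eq_of_totalDegree_le {Λ₁ Λ₂ : MvPolynomial (Fin n) ℝ →ₗ[ℝ] ℝ}
    (h₁ : IsSphereAverage Λ₁) (h₂ : IsSphereAverage Λ₂) (hn : 1 ≤ n) {e : ℕ}
    (hi₁ : IsInvariantInDegree Λ₁ (2 * e)) (hi₂ : IsInvariantInDegree Λ₂ (2 * e))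
    {f : MvPolynomial (Fin n) ℝ} (hf : f.totalDegree ≤ 2 * e + 1) : Λ₁ f = Λ₂ f := by
  rw [← f.sum_homogeneousComponent, map_sum, map_sum]
  refine Finset.sum_congr rfl fun d hd => ?_
  have hd' : d ≤ 2 * e + 1 := by rw [Finset.mem_range] at hd; omega
  have hh := MvPolynomial.homogeneousComponent_isHomogeneous d f
  rcases Nat.even_or_odd d with hev | hodd
  · obtain ⟨i, hi⟩ := hev
    -- Padding with powers of `‖x‖²` lifts an even component to degree exactly `2e`, the only degree
    -- where invariance is assumed.
    rw [← h₁.mul_normSqForm_pow _ (e - i), ← h₂.mul_normSqForm_pow _ (e - i)]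
    refine h₁.eq_of_isHomogeneous h₂ hn hi₁ hi₂ ?_
    convert hh.mul (isHomogeneous_normSqForm_pow n (e - i)) using 1
    omega
  · rw [apply_eq_zero_of_linForm_pow Λ₁ (fun v => h₁.odd v d hodd) hh,
      apply_eq_zero_of_linForm_pow Λ₂ (fun v => h₂.odd v d hodd) hh]

theorem aeval_linForm_X_pow (v : EuclideanSpace ℝ (Fin n)) (j : ℕ) :
    aeval (linForm v) (X ^ j : ℝ[X]) = linForm v ^ j := by simp

/-- Mixed moments of an invariant functional. -/
theorem apply_X_pow_mul_X_sq {Λ : MvPolynomial (Fin n) ℝ →ₗ[ℝ] ℝ} {j : ℕ}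
    (hi : IsInvariantInDegree Λ (2 * j + 2)) {a b : Fin n} (hab : b ≠ a) :
    (2 * (j : ℝ) + 1) * Λ (MvPolynomial.X a ^ (2 * j) * MvPolynomial.X b ^ 2) =
      Λ (MvPolynomial.X a ^ (2 * j + 2)) := by
  set P : ℝ[X] := ∑ i ∈ Finset.range (2 * j + 2 + 1), C (((2 * j + 2).choose i : ℝ) *
    Λ (MvPolynomial.X a ^ (2 * j + 2 - i) * MvPolynomial.X b ^ i)) * X ^ i with hP
  set c := Λ (MvPolynomial.X a ^ (2 * j + 2)) with hc
  -- Both sides are `Λ ((x_a + t x_b) ^ (2j+2))` as polynomials in `t`, since `‖u + t • e_b‖² = 1 +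
  -- t²`. Comparing coefficients of `t²` gives the claim.
  have hPeq : P = C c * (expand ℝ 2 ((1 + X) ^ (j + 1))) := by
    apply Polynomial.funext
    intro t
    set u := EuclideanSpace.single a (1 : ℝ)
    have hu : ‖u‖ = 1 := by simp [u]
    set w := u + t • EuclideanSpace.single b (1 : ℝ)
    have hw : ‖w‖ ^ 2 = 1 + t ^ 2 := by
      have horth : ⟪u, t • EuclideanSpace.single b (1 : ℝ)⟫ = 0 := by
        rw [inner_smul_right, EuclideanSpace.inner_single_left]
        simp [hab.symm]
      have := norm_add_sq_real u (t • EuclideanSpace.single b (1 : ℝ))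
      rw [horth, hu, norm_smul] at this
      simpa using this
    have h1 := hi.apply_linForm_pow hu w
    rw [show ‖w‖ ^ (2 * j + 2) = (‖w‖ ^ 2) ^ (j + 1) by ring, hw, linForm_single, ← hc] at h1
    have h2 : linForm w ^ (2 * j + 2) = ∑ i ∈ Finset.range (2 * j + 2 + 1),
        MvPolynomial.C (((2 * j + 2).choose i : ℝ) * t ^ i) *
          (MvPolynomial.X a ^ (2 * j + 2 - i) * MvPolynomial.X b ^ i) := by
      rw [linForm_add, linForm_smul, linForm_single, linForm_single, add_comm, add_pow]
      refine Finset.sum_congr rfl fun i _ => ?_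
      rw [mul_pow, map_mul, map_pow, map_natCast]
      ring
    rw [h2, map_sum] at h1
    rw [hP, eval_finsetSum, eval_mul, eval_C, expand_eval, mul_comm c]
    simp only [eval_pow, eval_add, eval_one, eval_X, ← h1, apply_mvC_mul, eval_mul, eval_C]
    exact Finset.sum_congr rfl fun i _ => by ring
  have h2 : P.coeff 2 = (C c * (expand ℝ 2 ((1 + X) ^ (j + 1)))).coeff 2 := by rw [hPeq]
  rw [hP, finsetSum_coeff, coeff_C_mul, show (2 : ℕ) = 1 * 2 by norm_num,
    coeff_expand_mul (by norm_num), coeff_one_add_X_pow, one_mul,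
    Finset.sum_eq_single 2 (by
      intro i _ hi2
      rw [coeff_C_mul, coeff_X_pow, if_neg (Ne.symm hi2), mul_zero]) (by simp),
    coeff_C_mul, coeff_X_pow, if_pos rfl, mul_one, show 2 * j + 2 - 2 = 2 * j by omega,
    Nat.choose_one_right, Nat.cast_choose_two] at h2
  push_cast at h2
  have hne : (j : ℝ) + 1 ≠ 0 := by positivity
  apply mul_left_cancel₀ hne
  linear_combination h2

/-- For the even moments, insert the factor `‖x‖²` into `x_a ^ (2j)`: one term is the next moment,
and each of the other `n - 1` terms is `1 / (2j+1)` times it. -/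
theorem IsSphereAverage.isGegenbauerFunctional {Λ : MvPolynomial (Fin n) ℝ →ₗ[ℝ] ℝ}
    (h : IsSphereAverage Λ) (hi : ∀ d, IsInvariantInDegree Λ d)
    {v : EuclideanSpace ℝ (Fin n)} (hv : ‖v‖ = 1) :
    IsGegenbauerFunctional n (Λ ∘ₗ (aeval (linForm v)).toLinearMap) where
  one := by simp [h.one]
  odd j := by
    rw [LinearMap.comp_apply, AlgHom.toLinearMap_apply, aeval_linForm_X_pow]
    exact h.odd v _ (odd_two_mul_add_one j)
  even j := by
    simp only [LinearMap.comp_apply, AlgHom.toLinearMap_apply, aeval_linForm_X_pow]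
    have hn : 0 < n := by
      rcases Nat.eq_zero_or_pos n with rfl | hn
      · rw [Subsingleton.elim v 0, norm_zero] at hv
        exact absurd hv zero_ne_one
      · exact hn
    set a : Fin n := ⟨0, hn⟩
    have hva : ‖v‖ = ‖EuclideanSpace.single a (1 : ℝ)‖ := by simp [hv]
    rw [hi _ v _ hva, hi _ v _ hva, linForm_single,
      ← h.mul_normSqForm (MvPolynomial.X a ^ (2 * j)), normSqForm, Finset.mul_sum, map_sum,
      Finset.mul_sum, ← Finset.add_sum_erase _ _ (Finset.mem_univ a),
      Finset.sum_congr rfl fun b hb => apply_X_pow_mul_X_sq (hi (2 * j + 2))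
        (Finset.ne_of_mem_erase hb), Finset.sum_const, Finset.card_erase_of_mem (Finset.mem_univ a),
      Finset.card_univ, Fintype.card_fin, ← pow_add, nsmul_eq_mul, Nat.cast_pred hn]
    ring

end forms

/-! ### Integration over the unit sphere -/

section sphere

variable {n : ℕ}

/-- The action of a linear isometry on the unit sphere. -/
noncomputable def sphereMap (R : EuclideanSpace ℝ (Fin n) ≃ₗᵢ[ℝ] EuclideanSpace ℝ (Fin n))
    (u : Metric.sphere (0 : EuclideanSpace ℝ (Fin n)) 1) :
    Metric.sphere (0 : EuclideanSpace ℝ (Fin n)) 1 :=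
  ⟨R u, by simp⟩

theorem continuous_sphereMap (R : EuclideanSpace ℝ (Fin n) ≃ₗᵢ[ℝ] EuclideanSpace ℝ (Fin n)) :
    Continuous (sphereMap R) :=
  (R.continuous.comp continuous_subtype_val).subtype_mk _

/-- The surface measure of `s` is a multiple of the volume of the cone over `s`, and linear
isometries commute with forming cones and preserve volume. -/
theorem map_sphereMap_toSphere
    (R : EuclideanSpace ℝ (Fin n) ≃ₗᵢ[ℝ] EuclideanSpace ℝ (Fin n)) :
    Measure.map (sphereMap R) (volume : Measure (EuclideanSpace ℝ (Fin n))).toSphere =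
      (volume : Measure (EuclideanSpace ℝ (Fin n))).toSphere := by
  have hm := (continuous_sphereMap R).measurable
  ext s hs
  rw [Measure.map_apply hm hs, Measure.toSphere_apply' _ hs, Measure.toSphere_apply' _ (hm hs)]
  congr 1
  have hset : Set.Ioo (0 : ℝ) 1 • ((↑) '' (sphereMap R ⁻¹' s) : Set (EuclideanSpace ℝ (Fin n))) =
      R ⁻¹' (Set.Ioo (0 : ℝ) 1 • ((↑) '' s)) := by
    ext x
    simp only [Set.mem_smul, Set.mem_preimage, Set.mem_image]
    constructor
    · rintro ⟨t, ht, _, ⟨u, hu, rfl⟩, rfl⟩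
      exact ⟨t, ht, R u, ⟨sphereMap R u, hu, rfl⟩, by simp⟩
    · rintro ⟨t, ht, _, ⟨u, hu, rfl⟩, h⟩
      refine ⟨t, ht, _, ⟨sphereMap R.symm u, ?_, rfl⟩, ?_⟩
      · have : sphereMap R (sphereMap R.symm u) = u := Subtype.ext (by simp [sphereMap])
        rwa [this]
      · apply R.injective
        simp [sphereMap, h]
  rw [hset]
  exact R.measurePreserving.measure_preimage_emb R.toHomeomorph.measurableEmbedding _

theorem map_sphereMap_sphereMeasure
    (R : EuclideanSpace ℝ (Fin n) ≃ₗᵢ[ℝ] EuclideanSpace ℝ (Fin n)) :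
    Measure.map (sphereMap R) (sphereMeasure n) = sphereMeasure n := by
  rw [sphereMeasure, Measure.map_smul, map_sphereMap_toSphere]

theorem isProbabilityMeasure_sphereMeasure (hn : 1 ≤ n) :
    IsProbabilityMeasure (sphereMeasure n) := by
  have : Nonempty (Fin n) := ⟨⟨0, hn⟩⟩
  constructor
  rw [sphereMeasure, Measure.smul_apply, smul_eq_mul]
  refine ENNReal.inv_mul_cancel ?_ (measure_ne_top _ _)
  rw [Measure.measure_univ_ne_zero]
  exact Measure.toSphere_ne_zero _

theorem continuous_eval_sphere (f : MvPolynomial (Fin n) ℝ) :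
    Continuous fun u : Metric.sphere (0 : EuclideanSpace ℝ (Fin n)) 1 =>
      MvPolynomial.eval (fun i => (u : EuclideanSpace ℝ (Fin n)) i) f := by
  refine (MvPolynomial.continuous_eval f).comp (continuous_pi fun i => ?_)
  fun_prop

theorem integrable_eval_sphere (hn : 1 ≤ n) (f : MvPolynomial (Fin n) ℝ) :
    Integrable (fun u : Metric.sphere (0 : EuclideanSpace ℝ (Fin n)) 1 =>
      MvPolynomial.eval (fun i => (u : EuclideanSpace ℝ (Fin n)) i) f) (sphereMeasure n) := by
  have := isProbabilityMeasure_sphereMeasure hn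
  exact (continuous_eval_sphere f).integrable_of_hasCompactSupport
    (HasCompactSupport.of_compactSpace _)

/-- Integration of polynomials over the unit sphere. -/
noncomputable def sphereIntegral (hn : 1 ≤ n) : MvPolynomial (Fin n) ℝ →ₗ[ℝ] ℝ where
  toFun f := ∫ u : Metric.sphere (0 : EuclideanSpace ℝ (Fin n)) 1,
    MvPolynomial.eval (fun i => (u : EuclideanSpace ℝ (Fin n)) i) f ∂(sphereMeasure n)
  map_add' f g := by
    simp only [map_add]
    exact integral_add (integrable_eval_sphere hn f) (integrable_eval_sphere hn g)
  map_smul' c f := by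
    simp only [MvPolynomial.smul_eval, RingHom.id_apply, smul_eq_mul]
    exact integral_const_mul c _

theorem sphereIntegral_apply (hn : 1 ≤ n) (f : MvPolynomial (Fin n) ℝ) :
    sphereIntegral hn f = ∫ u : Metric.sphere (0 : EuclideanSpace ℝ (Fin n)) 1,
      MvPolynomial.eval (fun i => (u : EuclideanSpace ℝ (Fin n)) i) f ∂(sphereMeasure n) := rfl

/-- A linear isometry taking a vector to another one of the same length. -/
theorem exists_linearIsometryEquiv_apply_eq {v w : EuclideanSpace ℝ (Fin n)} (h : ‖v‖ = ‖w‖) :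
    ∃ R : EuclideanSpace ℝ (Fin n) ≃ₗᵢ[ℝ] EuclideanSpace ℝ (Fin n), R v = w :=
  ⟨(ℝ ∙ (v - w))ᗮ.reflection, Submodule.reflection_sub h⟩

theorem sphereIntegral_isInvariantInDegree (hn : 1 ≤ n) (d : ℕ) :
    IsInvariantInDegree (sphereIntegral hn) d := by
  intro v w hvw
  obtain ⟨R, rfl⟩ := exists_linearIsometryEquiv_apply_eq hvw
  rw [sphereIntegral_apply, sphereIntegral_apply]
  conv_rhs => rw [← map_sphereMap_sphereMeasure R]
  rw [integral_map (continuous_sphereMap R).aemeasurable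
    (continuous_eval_sphere _).aestronglyMeasurable]
  congr 1
  ext u
  rw [map_pow, map_pow, eval_linForm, eval_linForm]
  simp [sphereMap]

theorem sphereIntegral_isSphereAverage (hn : 1 ≤ n) : IsSphereAverage (sphereIntegral hn) where
  one := by
    have := isProbabilityMeasure_sphereMeasure hn
    simp [sphereIntegral_apply]
  mul_normSqForm f := by
    rw [sphereIntegral_apply, sphereIntegral_apply]
    congr 1
    ext u
    simp [eval_normSqForm]
  odd v d hd := by
    have h := sphereIntegral_isInvariantInDegree hn d v (-v) (norm_neg v).symm
    rw [linForm_neg, hd.neg_pow, map_neg] at h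
    linarith

end sphere

/-! ### Antipodal codes meeting the bound for their number of distances -/

section codes

variable {n : ℕ}

theorem finrank_homogeneousSubmodule (n e : ℕ) :
    Module.finrank ℝ (MvPolynomial.homogeneousSubmodule (Fin n) ℝ e) =
      (n + e - 1).choose e := by
  have hset : {d : Fin n →₀ ℕ | d.degree = e} =
      ((Finset.univ : Finset (Fin n)).finsuppAntidiag e : Set (Fin n →₀ ℕ)) := by
    ext d
    simp [Finset.mem_finsuppAntidiag, Finsupp.degree_eq_sum]
  rw [MvPolynomial.homogeneousSubmodule_eq_finsupp_supported, hset,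
    (AddMonoidAlgebra.supportedEquivFinsupp (R := ℝ) (S := ℝ) _).finrank_eq,
    Module.finrank_finsupp_self, ← Nat.card_eq_fintype_card, Nat.card_coe_set_eq,
    Set.ncard_coe_finset, Finset.card_finsuppAntidiag_nat_eq_choose,
    Finset.card_univ, Fintype.card_fin]

theorem eval_neg_of_isHomogeneous {f : MvPolynomial (Fin n) ℝ} {e : ℕ} (hf : f.IsHomogeneous e)
    (x : EuclideanSpace ℝ (Fin n)) :
    MvPolynomial.eval (fun i => (-x) i) f = (-1) ^ e * MvPolynomial.eval (fun i => x i) f := by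
  rw [MvPolynomial.eval_eq, MvPolynomial.eval_eq, Finset.mul_sum]
  refine Finset.sum_congr rfl fun d hd => ?_
  have h1 : d.degree = e := by
    rw [Finsupp.degree_eq_weight_one]
    exact hf (MvPolynomial.mem_support_iff.1 hd)
  have h2 : ∏ i ∈ d.support, ((-x) i) ^ d i = (-1) ^ e * ∏ i ∈ d.support, (x i) ^ d i := by
    rw [← h1, Finsupp.degree_apply, ← Finset.prod_pow_eq_pow_sum, ← Finset.prod_mul_distrib]
    exact Finset.prod_congr rfl fun i _ => by rw [PiLp.neg_apply, neg_pow]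
  rw [h2]
  ring

/-- On the unit sphere, a zonal function of the parity of `e` and of degree at most `e` is a
homogeneous polynomial of degree `e`. -/
theorem exists_isHomogeneous_eval_eq {g : ℝ[X]} {e : ℕ} (hdeg : g.natDegree ≤ e)
    (hpar : ∀ u, g.eval (-u) = (-1) ^ e * g.eval u) (y : EuclideanSpace ℝ (Fin n)) :
    ∃ F : MvPolynomial (Fin n) ℝ, F.IsHomogeneous e ∧
      ∀ x : EuclideanSpace ℝ (Fin n), ‖x‖ = 1 →
        MvPolynomial.eval (fun i => x i) F = g.eval ⟪y, x⟫ := by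
  refine ⟨∑ j ∈ Finset.range (e + 1), if Even (e + j) then MvPolynomial.C (g.coeff j) *
    (linForm y ^ j * normSqForm n ^ ((e - j) / 2)) else 0, ?_, fun x hx => ?_⟩
  · refine MvPolynomial.IsHomogeneous.sum _ _ _ fun j hj => ?_
    split_ifs with h
    · rw [Finset.mem_range] at hj
      rw [Nat.even_iff] at h
      convert (MvPolynomial.isHomogeneous_C (Fin n) (g.coeff j)).mul
        ((isHomogeneous_linForm_pow y j).mul (isHomogeneous_normSqForm_pow n ((e - j) / 2)))
        using 1
      omega
    · exact MvPolynomial.isHomogeneous_zero _ _ _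
  -- Symmetrizing by the parity of `g` shows that the coefficients dropped in the witness contribute
  -- nothing.
  · have h1 : g.eval ⟪y, x⟫ = (g.eval ⟪y, x⟫ + (-1) ^ e * g.eval (-⟪y, x⟫)) / 2 := by
      rw [hpar, ← mul_assoc, ← mul_pow]
      norm_num
    rw [h1, eval_eq_sum_range' (Nat.lt_succ_of_le hdeg), eval_eq_sum_range'
      (Nat.lt_succ_of_le hdeg), map_sum, Finset.mul_sum, ← Finset.sum_add_distrib,
      Finset.sum_div]
    refine Finset.sum_congr rfl fun j _ => ?_
    rw [neg_pow ⟪y, x⟫]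
    rcases Nat.even_or_odd (e + j) with h | h
    · rw [if_pos h]
      have h2 : ((-1 : ℝ)) ^ e * (-1) ^ j = 1 := by rw [← pow_add, h.neg_one_pow]
      simp only [map_mul, map_pow, MvPolynomial.eval_C, eval_linForm, eval_normSqForm, hx,
        one_pow, mul_one]
      linear_combination (-(g.coeff j * ⟪y, x⟫ ^ j) / 2) * h2
    · rw [if_neg (Nat.not_even_iff_odd.2 h), map_zero]
      have h2 : ((-1 : ℝ)) ^ e * (-1) ^ j = -1 := by rw [← pow_add, h.neg_one_pow]
      linear_combination (-(g.coeff j * ⟪y, x⟫ ^ j) / 2) * h2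

/-- Evaluation on `Y` is surjective because the forms `F y` are dual to the points. Equality of
dimensions makes it injective, so a form agrees with its interpolant. -/
theorem eval_eq_sum_of_card_eq {Y : Finset (EuclideanSpace ℝ (Fin n))} {e : ℕ}
    (hcard : Y.card = (n + e - 1).choose e) (hunit : ∀ y ∈ Y, ‖y‖ = 1) {g : ℝ[X]}
    (hdeg : g.natDegree ≤ e) (hpar : ∀ u, g.eval (-u) = (-1) ^ e * g.eval u)
    (hg1 : g.eval 1 = 1) (hg0 : ∀ x ∈ Y, ∀ y ∈ Y, x ≠ y → g.eval ⟪x, y⟫ = 0)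
    {p : MvPolynomial (Fin n) ℝ} (hp : p.IsHomogeneous e) {x : EuclideanSpace ℝ (Fin n)}
    (hx : ‖x‖ = 1) :
    MvPolynomial.eval (fun i => x i) p =
      ∑ y ∈ Y, MvPolynomial.eval (fun i => y i) p * g.eval ⟪y, x⟫ := by
  classical
  choose F hFhom hFeval using fun y : EuclideanSpace ℝ (Fin n) =>
    exists_isHomogeneous_eval_eq hdeg hpar y
  set H := MvPolynomial.homogeneousSubmodule (Fin n) ℝ e
  have : Module.Finite ℝ H :=
    Module.Finite.iff_fg.2 (MvPolynomial.homogeneousSubmodule_fg (Fin n) ℝ e)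
  let ev : H →ₗ[ℝ] (Y → ℝ) :=
    { toFun := fun f y => MvPolynomial.eval (fun i => (y : EuclideanSpace ℝ (Fin n)) i) f.1
      map_add' := fun f g => by ext; simp
      map_smul' := fun c f => by ext; simp }
  have hδ (y z : EuclideanSpace ℝ (Fin n)) (hy : y ∈ Y) (hz : z ∈ Y) :
      MvPolynomial.eval (fun i => z i) (F y) = if y = z then 1 else 0 := by
    rw [hFeval y z (hunit z hz)]
    split_ifs with h
    · rw [h, real_inner_self_eq_norm_sq, hunit z hz, one_pow, hg1]
    · exact hg0 y hy z hz h
  let comb (c : EuclideanSpace ℝ (Fin n) → ℝ) : H :=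
    ⟨∑ y ∈ Y, MvPolynomial.C (c y) * F y, Submodule.sum_mem _ fun y _ => by
      rw [MvPolynomial.mem_homogeneousSubmodule]
      simpa using (MvPolynomial.isHomogeneous_C (Fin n) (c y)).mul (hFhom y)⟩
  have hcomb (c : EuclideanSpace ℝ (Fin n) → ℝ) (z : Y) : ev (comb c) z = c z := by
    change MvPolynomial.eval _ (∑ y ∈ Y, MvPolynomial.C (c y) * F y) = c z
    rw [map_sum, Finset.sum_eq_single z.1]
    · rw [map_mul, MvPolynomial.eval_C, hδ z.1 z.1 z.2 z.2, if_pos rfl, mul_one]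
    · intro y hy hyz
      rw [map_mul, hδ y z.1 hy z.2, if_neg hyz, mul_zero]
    · exact fun h => absurd z.2 h
  have hsurj : Function.Surjective ev := fun c =>
    ⟨comb fun y => if h : y ∈ Y then c ⟨y, h⟩ else 0, by
      ext z
      rw [hcomb, dif_pos z.2]⟩
  have hrank : Module.finrank ℝ H = Module.finrank ℝ (Y → ℝ) := by
    rw [finrank_homogeneousSubmodule, Module.finrank_fintype_fun_eq_card, Fintype.card_coe, hcard]
  have hinj := (LinearMap.injective_iff_surjective_of_finrank_eq_finrank hrank).2 hsurj
  have heq : (⟨p, hp⟩ : H) = comb fun y => MvPolynomial.eval (fun i => y i) p := by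
    apply hinj
    ext z
    rw [hcomb]
    rfl
  have heq' : p = ∑ y ∈ Y, MvPolynomial.C (MvPolynomial.eval (fun i => y i) p) * F y :=
    congrArg Subtype.val heq
  conv_lhs => rw [heq']
  rw [map_sum]
  exact Finset.sum_congr rfl fun y _ => by rw [map_mul, MvPolynomial.eval_C, hFeval y x hx]

/-- A finite antipodal set is the disjoint union of a half and its negative. -/
theorem exists_half (X : Finset (EuclideanSpace ℝ (Fin n))) (hneg : ∀ x ∈ X, -x ∈ X)
    (h0 : ∀ x ∈ X, x ≠ 0) :
    ∃ Y ⊆ X, (∀ y ∈ Y, -y ∉ Y) ∧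
      ∀ f : EuclideanSpace ℝ (Fin n) → ℝ, ∑ x ∈ X, f x = ∑ y ∈ Y, (f y + f (-y)) := by
  classical
  have hasymm {x : EuclideanSpace ℝ (Fin n)} (h : WellOrderingRel (-x) x) :
      ¬ WellOrderingRel x (-x) := fun h' => asymm h h'
  refine ⟨X.filter fun x => WellOrderingRel (-x) x, Finset.filter_subset _ _, ?_, fun f => ?_⟩
  · intro y hy hy'
    rw [Finset.mem_filter] at hy hy'
    rw [neg_neg] at hy'
    exact hasymm hy.2 hy'.2
  · rw [Finset.sum_add_distrib, ← Finset.sum_filter_add_sum_filter_not X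
      (fun x => WellOrderingRel (-x) x) f]
    congr 1
    refine Finset.sum_nbij' (fun x => -x) (fun x => -x) ?_ ?_ (by simp) (by simp) (by simp)
    · intro x hx
      rw [Finset.mem_filter] at hx ⊢
      refine ⟨hneg x hx.1, ?_⟩
      rw [neg_neg]
      rcases trichotomous_of WellOrderingRel x (-x) with h | h | h
      · exact h
      · have h2 : (2 : ℝ) • x = 0 := by rw [two_smul, add_eq_zero_iff_eq_neg, ← h]
        exact absurd ((smul_eq_zero.1 h2).resolve_left two_ne_zero) (h0 x hx.1)
      · exact absurd h hx.2
    · intro x hx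
      rw [Finset.mem_filter] at hx ⊢
      refine ⟨hneg x hx.1, ?_⟩
      rw [neg_neg]
      exact hasymm hx.2

/-- The data of an antipodal spherical code `X` of size `2 * binom(n+e-1, e)`, together with a
polynomial of degree at most `e` vanishing at the inner products other than `±1`. -/
structure IsTightCode (X : Finset (EuclideanSpace ℝ (Fin n))) (e : ℕ) (g : ℝ[X]) : Prop where
  norm_eq_one : ∀ x ∈ X, ‖x‖ = 1
  neg_mem : ∀ x ∈ X, -x ∈ X
  card_eq : X.card = 2 * (n + e - 1).choose e
  natDegree_le : g.natDegree ≤ e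
  eval_neg : ∀ u, g.eval (-u) = (-1) ^ e * g.eval u
  eval_one : g.eval 1 = 1
  eval_inner : ∀ x ∈ X, ∀ y ∈ X, x ≠ y → x ≠ -y → g.eval ⟪x, y⟫ = 0

/-- The average over a finite set. -/
noncomputable def codeAverage (X : Finset (EuclideanSpace ℝ (Fin n))) :
    MvPolynomial (Fin n) ℝ →ₗ[ℝ] ℝ where
  toFun f := (1 / (X.card : ℝ)) * ∑ x ∈ X, MvPolynomial.eval (fun i => x i) f
  map_add' f g := by simp [Finset.sum_add_distrib, mul_add]
  map_smul' c f := by simp [← Finset.mul_sum]; ring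

theorem codeAverage_apply (X : Finset (EuclideanSpace ℝ (Fin n))) (f : MvPolynomial (Fin n) ℝ) :
    codeAverage X f = (1 / (X.card : ℝ)) * ∑ x ∈ X, MvPolynomial.eval (fun i => x i) f := rfl

namespace IsTightCode

variable {X : Finset (EuclideanSpace ℝ (Fin n))} {e : ℕ} {g : ℝ[X]}

/-- The zonal functions `x ↦ g ⟪y, x⟫ / 2` reproduce homogeneous polynomials of degree `e` from
their values on the code. -/
theorem two_mul_eval (h : IsTightCode X e g) {p : MvPolynomial (Fin n) ℝ}
    (hp : p.IsHomogeneous e) {x : EuclideanSpace ℝ (Fin n)} (hx : ‖x‖ = 1) :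
    2 * MvPolynomial.eval (fun i => x i) p =
      ∑ y ∈ X, MvPolynomial.eval (fun i => y i) p * g.eval ⟪y, x⟫ := by
  obtain ⟨Y, hYX, hYneg, hsum⟩ := exists_half X h.neg_mem fun x hx h0 => by
    have := h.norm_eq_one x hx
    rw [h0, norm_zero] at this
    exact zero_ne_one this
  have hcard : Y.card = (n + e - 1).choose e := by
    have h1 := hsum fun _ => 1
    rw [Finset.sum_const, Finset.sum_const, h.card_eq] at h1
    simp only [nsmul_eq_mul, Nat.cast_mul, Nat.cast_ofNat, mul_one] at h1
    have h2 : (Y.card : ℝ) = ((n + e - 1).choose e : ℕ) := by linarith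
    exact_mod_cast h2
  rw [eval_eq_sum_of_card_eq hcard (fun y hy => h.norm_eq_one y (hYX hy)) h.natDegree_le
    h.eval_neg h.eval_one (fun x hx y hy hxy => h.eval_inner x (hYX hx) y (hYX hy) hxy
      (by rintro rfl; exact hYneg y hy hx)) hp hx, hsum, Finset.mul_sum]
  refine Finset.sum_congr rfl fun y _ => ?_
  rw [eval_neg_of_isHomogeneous hp, inner_neg_left, h.eval_neg]
  have h2 : ((-1 : ℝ)) ^ e * (-1) ^ e = 1 := by rw [← mul_pow]; norm_num
  linear_combination (-(MvPolynomial.eval (fun i => y i) p * g.eval ⟪y, x⟫)) * h2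

/-- Consider the double sum over `x, y ∈ X` of `⟪v, y⟫ ^ e * ⟪R v, x⟫ ^ e * g ⟪x, R y⟫`. Reproducing
in `y` at the point `R.symm x` gives `2 ∑ x, ⟪R v, x⟫ ^ (2e)`; reproducing in `x` at `R y` gives `2
∑ y, ⟪v, y⟫ ^ (2e)`. -/
theorem isInvariantInDegree (h : IsTightCode X e g) :
    IsInvariantInDegree (codeAverage X) (2 * e) := by
  intro v w hvw
  obtain ⟨R, rfl⟩ := exists_linearIsometryEquiv_apply_eq hvw
  simp only [codeAverage_apply, map_pow, eval_linForm]
  congr 1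
  have key (u x : EuclideanSpace ℝ (Fin n)) (hx : ‖x‖ = 1) :
      2 * ⟪u, x⟫ ^ e = ∑ y ∈ X, ⟪u, y⟫ ^ e * g.eval ⟪y, x⟫ := by
    simpa only [map_pow, eval_linForm] using h.two_mul_eval (isHomogeneous_linForm_pow u e) hx
  have hR (x y : EuclideanSpace ℝ (Fin n)) : ⟪R.symm x, y⟫ = ⟪x, R y⟫ := by
    rw [← R.inner_map_map, R.apply_symm_apply]
  have h1 : ∑ x ∈ X, ⟪R v, x⟫ ^ e * (2 * ⟪v, R.symm x⟫ ^ e) =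
      ∑ y ∈ X, ⟪v, y⟫ ^ e * (2 * ⟪R v, R y⟫ ^ e) := by
    have h2 : ∀ x ∈ X, ⟪R v, x⟫ ^ e * (2 * ⟪v, R.symm x⟫ ^ e) =
        ∑ y ∈ X, ⟪v, y⟫ ^ e * (⟪R v, x⟫ ^ e * g.eval ⟪x, R y⟫) := fun x hx => by
      rw [key v (R.symm x) (by rw [R.symm.norm_map, h.norm_eq_one x hx]), Finset.mul_sum]
      refine Finset.sum_congr rfl fun y _ => ?_
      rw [real_inner_comm (R.symm x) y, hR]
      ring
    rw [Finset.sum_congr rfl h2, Finset.sum_comm]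
    refine Finset.sum_congr rfl fun y hy => ?_
    rw [key (R v) (R y) (by rw [R.norm_map, h.norm_eq_one y hy]), Finset.mul_sum]
  simp only [R.inner_map_map] at h1
  have h3 (x : EuclideanSpace ℝ (Fin n)) : ⟪v, R.symm x⟫ = ⟪R v, x⟫ := by
    rw [real_inner_comm, hR, real_inner_comm]
  simp only [h3, mul_left_comm _ (2 : ℝ), ← pow_add, ← two_mul, ← Finset.mul_sum] at h1
  linarith

theorem card_ne_zero (h : IsTightCode X e g) (hn : 1 ≤ n) : (X.card : ℝ) ≠ 0 := by
  have : 0 < (n + e - 1).choose e := Nat.choose_pos (by omega)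
  rw [h.card_eq]
  positivity

theorem isSphereAverage (h : IsTightCode X e g) (hn : 1 ≤ n) :
    IsSphereAverage (codeAverage X) where
  one := by
    have := h.card_ne_zero hn
    simp [codeAverage_apply, this]
  mul_normSqForm f := by
    rw [codeAverage_apply, codeAverage_apply]
    congr 1
    refine Finset.sum_congr rfl fun x hx => ?_
    rw [map_mul, eval_normSqForm, h.norm_eq_one x hx, one_pow, mul_one]
  odd v d hd := by
    simp only [codeAverage_apply, map_pow, eval_linForm]
    have h1 : ∑ x ∈ X, ⟪v, x⟫ ^ d = ∑ x ∈ X, -⟪v, x⟫ ^ d :=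
      Finset.sum_nbij' (fun x => -x) (fun x => -x) h.neg_mem h.neg_mem (by simp) (by simp)
        (fun x _ => by simp only [inner_neg_right, hd.neg_pow, neg_neg])
    rw [Finset.sum_neg_distrib] at h1
    have h2 : ∑ x ∈ X, ⟪v, x⟫ ^ d = 0 := by linarith
    rw [h2, mul_zero]

theorem codeAverage_eq_sphereIntegral (h : IsTightCode X e g) (hn : 1 ≤ n)
    {f : MvPolynomial (Fin n) ℝ} (hf : f.totalDegree ≤ 2 * e + 1) :
    codeAverage X f = sphereIntegral hn f :=
  (h.isSphereAverage hn).eq_of_totalDegree_le (sphereIntegral_isSphereAverage hn) hn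
    h.isInvariantInDegree (sphereIntegral_isInvariantInDegree hn _) hf

end IsTightCode

end codes

/-! ### Zonal polynomials and their integrals -/

section zonal

variable {n : ℕ}

theorem totalDegree_aeval_linForm_le (v : EuclideanSpace ℝ (Fin n)) (f : ℝ[X]) :
    (aeval (linForm v) f).totalDegree ≤ f.natDegree := by
  rw [aeval_eq_sum_range]
  refine MvPolynomial.totalDegree_finsetSum_le fun j hj => ?_
  rw [Finset.mem_range] at hj
  exact (MvPolynomial.totalDegree_smul_le _ _).trans
    ((isHomogeneous_linForm_pow v j).totalDegree_le.trans (by omega))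

theorem eval_aeval_linForm (v x : EuclideanSpace ℝ (Fin n)) (f : ℝ[X]) :
    MvPolynomial.eval (fun i => x i) (aeval (linForm v) f) = f.eval ⟪v, x⟫ := by
  rw [aeval_def, hom_eval₂, eval_linForm, ← eval₂_id]
  congr 1
  ext
  simp

theorem sphereIntegral_aeval_linForm (hn : 1 ≤ n) {v w : EuclideanSpace ℝ (Fin n)}
    (hvw : ‖v‖ = ‖w‖) (f : ℝ[X]) :
    sphereIntegral hn (aeval (linForm v) f) = sphereIntegral hn (aeval (linForm w) f) := by
  simp only [aeval_eq_sum_range, map_sum, map_smul]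
  exact Finset.sum_congr rfl fun j _ => by
    rw [sphereIntegral_isInvariantInDegree hn j v w hvw]

/-- For `n ≥ 2` the sphere is connected, so the intermediate value theorem applies between `-y` and
`y`. -/
theorem exists_norm_eq_one_inner_eq (hn : 2 ≤ n) {y : EuclideanSpace ℝ (Fin n)} (hy : ‖y‖ = 1)
    {u : ℝ} (hu : u ∈ Set.Icc (-1 : ℝ) 1) :
    ∃ v : EuclideanSpace ℝ (Fin n), ‖v‖ = 1 ∧ ⟪v, y⟫ = u := by
  have hrank : 1 < Module.rank ℝ (EuclideanSpace ℝ (Fin n)) := by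
    have := Module.lt_rank_of_lt_finrank (R := ℝ) (M := EuclideanSpace ℝ (Fin n)) (n := 1)
      (by rw [finrank_euclideanSpace_fin]; omega)
    simpa using this
  have hc : ContinuousOn (fun v : EuclideanSpace ℝ (Fin n) => ⟪v, y⟫) (Metric.sphere 0 1) := by
    fun_prop
  have h := (isPreconnected_sphere hrank (0 : EuclideanSpace ℝ (Fin n)) 1).intermediate_value
    (a := -y) (b := y) (by simp [hy]) (by simp [hy]) hc
  simp only [inner_neg_left, real_inner_self_eq_norm_sq, hy, one_pow] at h
  obtain ⟨v, hv, hvu⟩ := h hu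
  exact ⟨v, by simpa using hv, hvu⟩

theorem inner_mem_Icc {v y : EuclideanSpace ℝ (Fin n)} (hv : ‖v‖ = 1) (hy : ‖y‖ = 1) :
    ⟪v, y⟫ ∈ Set.Icc (-1 : ℝ) 1 := by
  have := abs_real_inner_le_norm v y
  rw [hv, hy, mul_one, abs_le] at this
  exact this

end zonal

namespace IsTightCode

variable {n : ℕ} {X : Finset (EuclideanSpace ℝ (Fin n))} {e : ℕ} {g : ℝ[X]}

theorem nonempty (h : IsTightCode X e g) (hn : 1 ≤ n) : X.Nonempty := by
  rw [← Finset.card_ne_zero]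
  exact_mod_cast h.card_ne_zero hn

/-- A polynomial of degree at most `2e+1` which is nonnegative on `[-1, 1]` and whose zonal
integral vanishes is zero. -/
theorem eq_zero_of_nonneg (h : IsTightCode X e g) (hn : 2 ≤ n) {v : EuclideanSpace ℝ (Fin n)}
    (hv : ‖v‖ = 1) {f : ℝ[X]} (hdeg : f.natDegree ≤ 2 * e + 1)
    (hnn : ∀ u ∈ Set.Icc (-1 : ℝ) 1, 0 ≤ f.eval u)
    (h0 : sphereIntegral (one_le_two.trans hn) (aeval (linForm v) f) = 0) : f = 0 := by
  obtain ⟨y, hy⟩ := h.nonempty (one_le_two.trans hn)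
  apply eq_zero_of_infinite_isRoot
  refine (Set.Icc_infinite (show (-1 : ℝ) < 1 by norm_num)).mono fun u hu => ?_
  obtain ⟨w, hw, rfl⟩ := exists_norm_eq_one_inner_eq hn (h.norm_eq_one y hy) hu
  -- The zonal integral does not depend on the unit vector, so the design average vanishes for every
  -- `w`. Its terms are nonnegative, hence the single term at `y` vanishes, and `⟪w, y⟫` sweeps out
  -- `[-1, 1]`.
  rw [sphereIntegral_aeval_linForm _ (hv.trans hw.symm), ← h.codeAverage_eq_sphereIntegral _
    ((totalDegree_aeval_linForm_le w f).trans hdeg), codeAverage_apply] at h0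
  simp only [eval_aeval_linForm] at h0
  have h1 := (mul_eq_zero.1 h0).resolve_left
    (one_div_ne_zero (h.card_ne_zero (one_le_two.trans hn)))
  exact (Finset.sum_eq_zero_iff_of_nonneg
    fun x hx => hnn _ (inner_mem_Icc hw (h.norm_eq_one x hx))).1 h1 y hy

/-- The difference `D` of the two sides is orthogonal to all powers up to its own degree bound, so
the integral of `D ^ 2` vanishes and positivity gives `D = 0`. -/
theorem C_mul_eq_gegenbauerSum (h : IsTightCode X e g) (hn : 2 ≤ n) :
    C ((n + e - 1).choose e : ℝ) * g = gegenbauerSum n e := by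
  have hn1 : 1 ≤ n := one_le_two.trans hn
  obtain ⟨v, hv⟩ := h.nonempty hn1
  replace hv := h.norm_eq_one v hv
  set φ := sphereIntegral hn1 ∘ₗ (aeval (linForm v)).toLinearMap with hφ
  have hG : IsGegenbauerFunctional n φ :=
    (sphereIntegral_isSphereAverage hn1).isGegenbauerFunctional
      (sphereIntegral_isInvariantInDegree hn1) hv
  have hM : ((n + e - 1).choose e : ℝ) ≠ 0 := by
    have := Nat.choose_pos (show e ≤ n + e - 1 by omega)
    positivity
  set D := C ((n + e - 1).choose e : ℝ) * g - gegenbauerSum n e with hD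
  have hDdeg : D.natDegree ≤ e :=
    (natDegree_sub_le _ _).trans (max_le ((natDegree_C_mul_le _ _).trans h.natDegree_le)
      (natDegree_gegenbauerSum_le n e))
  have hgcomp : g.comp (-Polynomial.X) = (-1) ^ e * g :=
    Polynomial.funext fun u => by simpa using h.eval_neg u
  have hDcomp : D.comp (-Polynomial.X) = (-1) ^ e * D := by
    rw [hD, sub_comp, mul_comp, C_comp, gegenbauerSum_comp_neg_X, hgcomp]
    ring
  have hXD : ∀ j ≤ e, φ (Polynomial.X ^ j * D) = 0 := by
    intro j hj
    rcases Nat.even_or_odd (j + e) with hpar | hpar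
    -- The reproducing formula for `⟪v, ·⟫ ^ j`, padded to degree `e`, evaluated at `v` itself.
    · have h1 : ∑ y ∈ X, ⟪v, y⟫ ^ j * g.eval ⟪v, y⟫ = 2 := by
        have hhom : (linForm v ^ j * normSqForm n ^ ((e - j) / 2)).IsHomogeneous e := by
          convert (isHomogeneous_linForm_pow v j).mul
            (isHomogeneous_normSqForm_pow n ((e - j) / 2)) using 1
          rw [Nat.even_iff] at hpar
          omega
        have h2 := h.two_mul_eval hhom hv
        simp only [map_mul, map_pow, eval_linForm, eval_normSqForm, hv,
          real_inner_self_eq_norm_sq, one_pow, mul_one] at h2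
        rw [h2]
        refine Finset.sum_congr rfl fun y hy => ?_
        rw [h.norm_eq_one y hy, one_pow, one_pow, mul_one, real_inner_comm]
      have h3 : φ (Polynomial.X ^ j * g) = 1 / ((n + e - 1).choose e : ℝ) := by
        rw [hφ, LinearMap.comp_apply, AlgHom.toLinearMap_apply,
          ← h.codeAverage_eq_sphereIntegral hn1 ((totalDegree_aeval_linForm_le _ _).trans
            (natDegree_mul_le.trans (by rw [natDegree_X_pow]; have := h.natDegree_le; omega))),
          codeAverage_apply]
        simp only [eval_aeval_linForm, eval_mul, eval_pow, eval_X]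
        rw [h1, h.card_eq]
        push_cast
        field_simp
      rw [hD, mul_sub, map_sub, mul_left_comm, IsGegenbauerFunctional.apply_C_mul, h3,
        hG.apply_X_pow_mul_gegenbauerSum hn1 hj hpar, mul_one_div_cancel hM, sub_self]
    · apply hG.apply_eq_zero_of_comp_neg_X
      rw [mul_comp, X_pow_comp, hDcomp, neg_pow, mul_mul_mul_comm, ← pow_add, hpar.neg_one_pow]
      ring
  have hDD : φ (D ^ 2) = 0 := by
    rw [sq]
    nth_rewrite 1 [D.as_sum_range_C_mul_X_pow' (Nat.lt_succ_of_le hDdeg)]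
    rw [Finset.sum_mul, map_sum]
    refine Finset.sum_eq_zero fun j hj => ?_
    rw [Finset.mem_range] at hj
    rw [mul_assoc, IsGegenbauerFunctional.apply_C_mul, hXD j (by omega), mul_zero]
  have hD0 : D ^ 2 = 0 := h.eq_zero_of_nonneg hn hv
    (natDegree_pow_le.trans (by omega)) (fun u _ => by rw [eval_pow]; positivity) hDD
  exact sub_eq_zero.1 (pow_eq_zero_iff two_ne_zero |>.1 hD0)

end IsTightCode

/-- The polynomial with simple zeros at the elements of `S` and value `1` at `1`. -/
noncomputable def normalizedNodal (S : Finset ℝ) : ℝ[X] :=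
  ∏ α ∈ S, C (1 / (1 - α)) * (X - C α)

theorem natDegree_normalizedNodal_le (S : Finset ℝ) : (normalizedNodal S).natDegree ≤ S.card := by
  refine (natDegree_prod_le _ _).trans ?_
  rw [Finset.card_eq_sum_ones]
  exact Finset.sum_le_sum fun α _ =>
    (natDegree_C_mul_le _ _).trans (natDegree_X_sub_C_le α)

theorem eval_normalizedNodal (S : Finset ℝ) (u : ℝ) :
    (normalizedNodal S).eval u = ∏ α ∈ S, 1 / (1 - α) * (u - α) := by
  simp [normalizedNodal, eval_prod]

theorem eval_one_normalizedNodal {S : Finset ℝ} (hS : (1 : ℝ) ∉ S) :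
    (normalizedNodal S).eval 1 = 1 := by
  rw [eval_normalizedNodal]
  refine Finset.prod_eq_one fun α hα => one_div_mul_cancel (sub_ne_zero.2 ?_)
  rintro rfl
  exact hS hα

theorem eval_normalizedNodal_eq_zero {S : Finset ℝ} {u : ℝ} (hu : u ∈ S) :
    (normalizedNodal S).eval u = 0 := by
  rw [eval_normalizedNodal]
  exact Finset.prod_eq_zero hu (by simp)

theorem eval_neg_normalizedNodal {S : Finset ℝ} (hS : ∀ α ∈ S, -α ∈ S) (u : ℝ) :
    (normalizedNodal S).eval (-u) = (-1) ^ S.card * (normalizedNodal S).eval u := by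
  rw [eval_normalizedNodal, eval_normalizedNodal, Finset.prod_mul_distrib,
    Finset.prod_mul_distrib, mul_left_comm]
  congr 1
  rw [← Finset.prod_const, ← Finset.prod_mul_distrib]
  refine Finset.prod_nbij' (fun α => -α) (fun α => -α) hS hS (by simp) (by simp) ?_
  intro α _
  ring

/-! ### Tight codes with a prescribed set of inner products -/

section nodal

variable {n : ℕ} {X : Finset (EuclideanSpace ℝ (Fin n))} {S : Finset ℝ}

theorem isTightCode_normalizedNodal (hunit : ∀ x ∈ X, ‖x‖ = 1) (hneg : ∀ x ∈ X, -x ∈ X)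
    (hcard : X.card = 2 * (n + S.card - 1).choose S.card) (hS1 : (1 : ℝ) ∉ S)
    (hSneg : ∀ α ∈ S, -α ∈ S)
    (hinner : ∀ x ∈ X, ∀ y ∈ X, x ≠ y → x ≠ -y → ⟪x, y⟫ ∈ S) :
    IsTightCode X S.card (normalizedNodal S) where
  norm_eq_one := hunit
  neg_mem := hneg
  card_eq := hcard
  natDegree_le := natDegree_normalizedNodal_le S
  eval_neg := eval_neg_normalizedNodal hSneg
  eval_one := eval_one_normalizedNodal hS1
  eval_inner x hx y hy h1 h2 := eval_normalizedNodal_eq_zero (hinner x hx y hy h1 h2)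

/-- In a tight code every admissible inner product occurs. -/
theorem IsTightCode.exists_inner_eq {g : ℝ[X]} (h : IsTightCode X S.card g) (hn : 2 ≤ n)
    (hinner : ∀ x ∈ X, ∀ y ∈ X, x ≠ y → x ≠ -y → ⟪x, y⟫ ∈ S) {α : ℝ} (hα : α ∈ S) :
    ∃ x ∈ X, ∃ y ∈ X, x ≠ y ∧ x ≠ -y ∧ ⟪x, y⟫ = α := by
  classical
  by_contra! hne
  obtain ⟨v, hvX⟩ := h.nonempty (one_le_two.trans hn)
  have hv := h.norm_eq_one v hvX
  -- If `α` never occurred, `(1 - u²) q²` would vanish at every inner product of `v` with the code,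
  -- the first factor handling `±1`. It is nonnegative on `[-1, 1]` and of degree at most `2 *
  -- S.card`, so positivity would make it zero.
  set q : ℝ[X] := ∏ β ∈ S.erase α, (Polynomial.X - C β) with hq
  have hq0 : q ≠ 0 := Finset.prod_ne_zero_iff.2 fun β _ => X_sub_C_ne_zero β
  have hp0 : (1 - Polynomial.X ^ 2 : ℝ[X]) ≠ 0 := by
    intro h0
    have := congrArg (eval 0) h0
    simp at this
  have hqdeg : q.natDegree = S.card - 1 := by
    rw [hq, natDegree_prod_of_monic _ _ fun β _ => monic_X_sub_C β]
    simp [Finset.card_erase_of_mem hα]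
  have hSpos : 0 < S.card := Finset.card_pos.2 ⟨α, hα⟩
  have hdeg : ((1 - Polynomial.X ^ 2) * q ^ 2 : ℝ[X]).natDegree ≤ 2 * S.card + 1 := by
    have h1 : (1 - Polynomial.X ^ 2 : ℝ[X]).natDegree ≤ 2 :=
      (natDegree_sub_le _ _).trans (by simp)
    have h2 : (q ^ 2).natDegree ≤ 2 * (S.card - 1) := by
      simp [hqdeg]
    exact natDegree_mul_le.trans (by omega)
  refine mul_ne_zero hp0 (pow_ne_zero 2 hq0) (h.eq_zero_of_nonneg hn hv hdeg ?_ ?_)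
  · intro u hu
    have : 0 ≤ 1 - u ^ 2 := by nlinarith [hu.1, hu.2]
    simp only [eval_mul, eval_sub, Polynomial.eval_one, eval_pow, eval_X]
    positivity
  · rw [← h.codeAverage_eq_sphereIntegral _ ((totalDegree_aeval_linForm_le v _).trans hdeg),
      codeAverage_apply, Finset.sum_eq_zero, mul_zero]
    intro y hy
    rw [eval_aeval_linForm]
    simp only [eval_mul, eval_sub, Polynomial.eval_one, eval_pow, eval_X]
    by_cases h1 : v = y
    · rw [← h1, real_inner_self_eq_norm_sq, hv]
      ring
    by_cases h2 : v = -y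
    · rw [h2, inner_neg_left, real_inner_self_eq_norm_sq, h.norm_eq_one y hy]
      ring
    have h3 : q.eval ⟪v, y⟫ = 0 := by
      rw [hq, eval_prod]
      exact Finset.prod_eq_zero (Finset.mem_erase.2
        ⟨hne v hvX y hy h1 h2, hinner v hvX y hy h1 h2⟩) (by simp)
    rw [h3]
    ring

theorem IsTightCode.innerProductSet_eq {g : ℝ[X]} (h : IsTightCode X S.card g) (hn : 2 ≤ n)
    (hinner : ∀ x ∈ X, ∀ y ∈ X, x ≠ y → x ≠ -y → ⟪x, y⟫ ∈ S) :
    innerProductSet (X : Set (EuclideanSpace ℝ (Fin n))) = {-1} ∪ (S : Set ℝ) := by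
  ext a
  constructor
  · rintro ⟨x, hx, y, hy, hxy, rfl⟩
    by_cases h2 : x = -y
    · left
      rw [h2, inner_neg_left, real_inner_self_eq_norm_sq, h.norm_eq_one y hy]
      simp
    · exact Or.inr (hinner x hx y hy hxy h2)
  · rintro (rfl | ha)
    · obtain ⟨x, hx⟩ := h.nonempty (one_le_two.trans hn)
      have h1 := h.norm_eq_one x hx
      have hin : ⟪x, -x⟫ = (-1 : ℝ) := by
        rw [inner_neg_right, real_inner_self_eq_norm_sq, h1, one_pow]
      refine ⟨x, hx, -x, h.neg_mem x hx, fun h0 => ?_, hin.symm⟩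
      rw [← h0, real_inner_self_eq_norm_sq, h1] at hin
      norm_num at hin
    · obtain ⟨x, hx, y, hy, hxy, _, rfl⟩ := h.exists_inner_eq hn hinner ha
      exact ⟨x, hx, y, hy, hxy, rfl⟩

theorem IsTightCode.annihilator_eq {g : ℝ[X]} (h : IsTightCode X S.card g) (hn : 2 ≤ n)
    (hS : (-1 : ℝ) ∉ S) (hinner : ∀ x ∈ X, ∀ y ∈ X, x ≠ y → x ≠ -y → ⟪x, y⟫ ∈ S) :
    annihilator (X : Set (EuclideanSpace ℝ (Fin n))) =
      C (1 / 2) * (1 + Polynomial.X) * normalizedNodal S := by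
  classical
  have hset : ({-1} ∪ (S : Set ℝ)) = ((insert (-1) S : Finset ℝ) : Set ℝ) := by
    rw [Finset.coe_insert, Set.singleton_union]
  rw [annihilator, h.innerProductSet_eq hn hinner, hset, finprod_mem_coe_finset,
    Finset.prod_insert hS, normalizedNodal]
  congr 1
  -- The factor at `α = -1` is `(u + 1) / 2`.
  rw [sub_neg_eq_add, one_add_one_eq_two, C_neg, sub_neg_eq_add, C_1, add_comm]

end nodal

/-! ### Shells of integral lattices -/

/-- The rational numbers `j / k` in the open interval `(-1, 1)`. -/
noncomputable def fractions (k : ℕ) : Finset ℝ :=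
  (Finset.Ioo (-(k : ℤ)) k).image fun j : ℤ => (j : ℝ) / k

theorem mem_fractions {k : ℕ} {a : ℝ} :
    a ∈ fractions k ↔ ∃ j : ℤ, -(k : ℤ) < j ∧ j < (k : ℤ) ∧ a = (j : ℝ) / (k : ℝ) := by
  simp only [fractions, Finset.mem_image, Finset.mem_Ioo, and_assoc, eq_comm (a := a)]

theorem card_fractions {k : ℕ} (hk : 1 ≤ k) : (fractions k).card = 2 * k - 1 := by
  have hk0 : (k : ℝ) ≠ 0 := by positivity
  rw [fractions, Finset.card_image_of_injective, Int.card_Ioo]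
  · omega
  · intro i j hij
    simpa [div_left_inj' hk0] using hij

theorem abs_lt_one_of_mem_fractions {k : ℕ} {a : ℝ} (ha : a ∈ fractions k) : |a| < 1 := by
  obtain ⟨j, h1, h2, rfl⟩ := mem_fractions.1 ha
  have hk : (0 : ℝ) < k := by
    have : 0 < k := by omega
    exact_mod_cast this
  rw [abs_div, abs_of_pos hk, div_lt_one hk, abs_lt]
  exact ⟨by exact_mod_cast h1, by exact_mod_cast h2⟩

theorem neg_mem_fractions {k : ℕ} {a : ℝ} (ha : a ∈ fractions k) : -a ∈ fractions k := by
  obtain ⟨j, h1, h2, rfl⟩ := mem_fractions.1 ha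
  exact mem_fractions.2 ⟨-j, by omega, by omega, by push_cast; ring⟩

section shell

variable {n k : ℕ} {L : Submodule ℤ (EuclideanSpace ℝ (Fin n))}

theorem mem_normalizedShell {x : EuclideanSpace ℝ (Fin n)} :
    x ∈ normalizedShell L k ↔ ∃ y ∈ shell L k, (1 / Real.sqrt k) • y = x := Iff.rfl

theorem neg_mem_normalizedShell {x : EuclideanSpace ℝ (Fin n)} (hx : x ∈ normalizedShell L k) :
    -x ∈ normalizedShell L k := by
  obtain ⟨y, hy, rfl⟩ := hx
  exact ⟨-y, ⟨L.neg_mem hy.1, by rw [norm_neg, hy.2]⟩, by simp⟩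

theorem norm_of_mem_normalizedShell (hk : 1 ≤ k) {x : EuclideanSpace ℝ (Fin n)}
    (hx : x ∈ normalizedShell L k) : ‖x‖ = 1 := by
  obtain ⟨y, hy, rfl⟩ := mem_normalizedShell.1 hx
  have h1 : ‖y‖ = Real.sqrt k := by rw [← hy.2, Real.sqrt_sq (norm_nonneg y)]
  have h2 : Real.sqrt k ≠ 0 := by positivity
  rw [norm_smul, h1, Real.norm_of_nonneg (by positivity), one_div_mul_cancel h2]

theorem inner_mem_fractions (hk : 1 ≤ k) (hL : IsIntegralLattice L)
    {x y : EuclideanSpace ℝ (Fin n)} (hx : x ∈ normalizedShell L k)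
    (hy : y ∈ normalizedShell L k) (h1 : x ≠ y) (h2 : x ≠ -y) : ⟪x, y⟫ ∈ fractions k := by
  have hxn := norm_of_mem_normalizedShell hk hx
  have hyn := norm_of_mem_normalizedShell hk hy
  have hlt : ⟪x, y⟫ < 1 := lt_of_le_of_ne (inner_mem_Icc hxn hyn).2 fun h =>
    h1 ((inner_eq_one_iff_of_norm_eq_one hxn hyn).1 h)
  have hgt : -1 < ⟪x, y⟫ := lt_of_le_of_ne (inner_mem_Icc hxn hyn).1 fun h =>
    h2 ((inner_eq_one_iff_of_norm_eq_one (𝕜 := ℝ) hxn ((norm_neg y).trans hyn)).1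
      (by rw [inner_neg_right, ← h, neg_neg]))
  obtain ⟨a, ha, rfl⟩ := mem_normalizedShell.1 hx
  obtain ⟨b, hb, rfl⟩ := mem_normalizedShell.1 hy
  obtain ⟨m, hm⟩ := hL a ha.1 b hb.1
  have hk0 : (0 : ℝ) < k := by exact_mod_cast hk
  have hin : ⟪(1 / Real.sqrt k) • a, (1 / Real.sqrt k) • b⟫ = (m : ℝ) / k := by
    rw [real_inner_smul_left, real_inner_smul_right, hm, ← mul_assoc, div_mul_div_comm,
      Real.mul_self_sqrt hk0.le]
    ring
  rw [hin] at hlt hgt ⊢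
  rw [div_lt_one hk0] at hlt
  rw [lt_div_iff₀ hk0, neg_one_mul] at hgt
  exact mem_fractions.2 ⟨m, by exact_mod_cast hgt, by exact_mod_cast hlt, rfl⟩

theorem ncard_normalizedShell (hk : 1 ≤ k) :
    (normalizedShell L k).ncard = (shell L k).ncard := by
  have h : (1 / Real.sqrt k) ≠ 0 := by positivity
  exact Set.ncard_image_of_injective _ (smul_right_injective _ h)

end shell

end LatticeShell

/-! ### The main theorem -/

open LatticeShell

theorem proposition3p1 (n k : ℕ) (hn : 2 ≤ n) (hk : 1 ≤ k)
    (L : Submodule ℤ (EuclideanSpace ℝ (Fin n))) [DiscreteTopology L] [IsZLattice ℝ L]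
    (hL : LatticeShell.IsIntegralLattice L)
    (heq : (LatticeShell.shell L k).ncard = 2 * (n + 2 * k - 2).choose (2 * k - 1)) :
    LatticeShell.innerProductSet (LatticeShell.normalizedShell L k) =
        {-1} ∪ {a : ℝ | ∃ j : ℤ, -(k : ℤ) < j ∧ j < (k : ℤ) ∧ a = (j : ℝ) / (k : ℝ)} ∧
      (LatticeShell.IsAntipodal (LatticeShell.normalizedShell L k) ∧
        LatticeShell.IsTightSphericalDesign (4 * k - 1) (LatticeShell.normalizedShell L k)) ∧
      Polynomial.C (2 * ((n + 2 * k - 2).choose (2 * k - 1) : ℝ)) *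
          LatticeShell.annihilator (LatticeShell.normalizedShell L k) =
        (1 + Polynomial.X) * LatticeShell.gegenbauerSum n (2 * k - 1) ∧
      {z : ℂ | Polynomial.aeval z (LatticeShell.gegenbauerSum n (2 * k - 1)) = 0} =
        {z : ℂ | ∃ j : ℤ, -(k : ℤ) < j ∧ j < (k : ℤ) ∧ z = (j : ℂ) / (k : ℂ)} := by
  have hn1 : 1 ≤ n := one_le_two.trans hn
  have hMpos : 0 < (n + 2 * k - 2).choose (2 * k - 1) := Nat.choose_pos (by omega)
  have hncard := (ncard_normalizedShell (L := L) hk).trans heq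
  -- `Set.ncard` is `0` on infinite sets, so a positive value gives finiteness.
  have hfin : (normalizedShell L k).Finite := Set.finite_of_ncard_ne_zero (by omega)
  obtain ⟨X, hX⟩ := hfin.exists_finset_coe
  have hmem (x : EuclideanSpace ℝ (Fin n)) : x ∈ X ↔ x ∈ normalizedShell L k := by
    rw [← hX, Finset.mem_coe]
  have hScard := card_fractions hk
  have hM : n + 2 * k - 2 = n + (2 * k - 1) - 1 := by omega
  have hXcard : X.card = 2 * (n + (2 * k - 1) - 1).choose (2 * k - 1) := by
    rw [← hX, Set.ncard_coe_finset] at hncard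
    rw [hncard, hM]
  have hinner : ∀ x ∈ X, ∀ y ∈ X, x ≠ y → x ≠ -y → ⟪x, y⟫ ∈ fractions k :=
    fun x hx y hy => inner_mem_fractions hk hL ((hmem x).1 hx) ((hmem y).1 hy)
  have hcode : IsTightCode X (fractions k).card (normalizedNodal (fractions k)) := by
    refine isTightCode_normalizedNodal (fun x hx => norm_of_mem_normalizedShell hk ((hmem x).1 hx))
      (fun x hx => (hmem _).2 (neg_mem_normalizedShell ((hmem x).1 hx))) (by rw [hScard, hXcard])
      (fun h => ?_) (fun α => neg_mem_fractions) hinner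
    simpa using abs_lt_one_of_mem_fractions h
  have hGeg := hcode.C_mul_eq_gegenbauerSum hn
  rw [hScard, ← hM] at hGeg
  have hM0 : ((n + 2 * k - 2).choose (2 * k - 1) : ℝ) ≠ 0 := by positivity
  refine ⟨?_, ⟨?_, ⟨⟨hfin, ?_, ?_, ?_⟩, ?_⟩⟩, ?_, ?_⟩
  · rw [← hX, hcode.innerProductSet_eq hn hinner]
    congr 1
    ext a
    exact mem_fractions
  · ext x
    rw [Set.mem_neg]
    exact ⟨neg_mem_normalizedShell, fun h => by simpa using neg_mem_normalizedShell h⟩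
  · rw [← hX]
    exact hcode.nonempty hn1
  · intro x hx
    simpa using norm_of_mem_normalizedShell hk hx
  · intro f hf
    -- With `e = 2k - 1` the design strength `2e + 1` is `4k - 1`.
    have h1 := hcode.codeAverage_eq_sphereIntegral hn1 (f := f) (by rw [hScard]; omega)
    rw [codeAverage_apply, sphereIntegral_apply] at h1
    rw [← hX, Set.ncard_coe_finset, finsum_mem_coe_finset]
    exact h1
  · rw [hncard, designBound, if_neg (by rw [Nat.even_iff]; omega),
      show (4 * k - 1) / 2 = 2 * k - 1 by omega, hM]
  · rw [← hX, hcode.annihilator_eq hn (fun h => by simpa using abs_lt_one_of_mem_fractions h)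
      hinner, ← hGeg, C_mul]
    have h2 : (C 2 * C (1 / 2) : ℝ[X]) = 1 := by rw [← C_mul]; norm_num
    linear_combination (C ((n + 2 * k - 2).choose (2 * k - 1) : ℝ) * (1 + Polynomial.X) *
      normalizedNodal (fractions k)) * h2
  · ext z
    simp only [Set.mem_ofPred_eq]
    -- The Gegenbauer sum is a nonzero multiple of the nodal polynomial, which splits into real
    -- linear factors, so its complex roots are the fractions.
    rw [← hGeg, map_mul, aeval_C, mul_eq_zero, or_iff_right (by simpa using hM0),
      normalizedNodal, map_prod, Finset.prod_eq_zero_iff]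
    have hfactor : ∀ α ∈ fractions k,
        (aeval z (C (1 / (1 - α)) * (Polynomial.X - C α)) = 0 ↔ z = (α : ℂ)) := by
      intro α hα
      have h1 : 1 / (1 - α) ≠ 0 :=
        one_div_ne_zero (sub_pos.2 (abs_lt.1 (abs_lt_one_of_mem_fractions hα)).2).ne'
      rw [map_mul, aeval_C, mul_eq_zero, or_iff_right ((_root_.map_ne_zero _).2 h1), map_sub, aeval_X,
        aeval_C, sub_eq_zero]
      rfl
    constructor
    · rintro ⟨α, hα, h0⟩
      obtain ⟨j, hj1, hj2, rfl⟩ := mem_fractions.1 hα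
      exact ⟨j, hj1, hj2, by rw [(hfactor _ hα).1 h0]; push_cast; rfl⟩
    · rintro ⟨j, hj1, hj2, rfl⟩
      have hα : (j : ℝ) / k ∈ fractions k := mem_fractions.2 ⟨j, hj1, hj2, rfl⟩
      exact ⟨_, hα, (hfactor _ hα).2 (by push_cast; rfl)⟩
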